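/- Consider a unit-cost word RAM with words of $w$ bits whose instruction set consists of arithmetic operations (addition, subtraction, multiplication, division, remainder), bitwise boolean operations and shifts; the input is read-only, and space is the number of words of working memory used, not counting the input and the reported output. Let $P$ and $Q$ be strings of lengths $m$ and $n$, $m\le n<2^w$, over an alphabet of size $\sigma\ge 2$, both given in packed representation: each character takes $\lceil\log_2\sigma\rceil$ bits, and every word stores $k\ge 1$ consecutive characters, where $k\lceil\log_2\sigma\rceil\le w$ and $k=\Omega(\log n/\log\sigma)$. Let $\mathrm{occ}$ be the number of positions at which $P$ occurs as a substring of $Q$. There is an algorithm (one program for all $w,\sigma,k,P,Q,t$) that, for every integer parameter $t$ with $2\le t<2^w$, given the packed strings $P$ and $Q$ together with $m$, $n$, $t$, $\lceil\log_2\sigma\rceil$ and $k$, reports every position at which $P$ occurs in $Q$ exactly once, in time $$O\left(\frac{n}{\log_\sigma t}+t+m+\mathrm{occ}\right)$$ and space $O(t+m)$. The constants in these bounds depend only on the constant in $k=\Omega(\log n/\log\sigma)$, that is, on a number $a$ with $\log_\sigma n\le a\,k$. -/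

import Mathlib

/-! A unit-cost word RAM with word length `w` (words are `BitVec w`), packed strings, and the
string matching problem. -/

namespace PackedMatching

/-! ### The word RAM -/

/-- Arithmetic, bitwise boolean and shift operations of the machine. -/
inductive BinOp where
  | add | sub | mul | div | mod
  | and | or | xor
  | shl | shr

/-- Words are unsigned, arithmetic is modulo `2 ^ w`; division rounds down; shifts are logical. -/
def BinOp.eval {w : ℕ} : BinOp → BitVec w → BitVec w → BitVec w
  | .add, x, y => x + y
  | .sub, x, y => x - y
  | .mul, x, y => x * y
  | .div, x, y => x / y
  | .mod, x, y => x % y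
  | .and, x, y => x &&& y
  | .or, x, y => x ||| y
  | .xor, x, y => x ^^^ y
  | .shl, x, y => x <<< y.toNat
  | .shr, x, y => x >>> y.toNat

/-- An operand of an instruction: a register or an immediate constant. -/
inductive Operand where
  | reg (i : ℕ)
  | lit (c : ℕ)

/-- The instructions. `readPat` and `readTxt` fetch one word of the read-only input, `load` and
`store` access the working memory (indirect addressing), `report` emits one word to the write-only
output. -/
inductive Instr where
  | nop
  | move (d : ℕ) (a : Operand)
  | op (o : BinOp) (d : ℕ) (a b : Operand)
  | load (d : ℕ) (addr : Operand)
  | store (addr v : Operand)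
  | readPat (d : ℕ) (idx : Operand)
  | readTxt (d : ℕ) (idx : Operand)
  | report (a : Operand)

/-- Tests that control branches and loops (unsigned comparison of two words). -/
inductive Test where
  | eq (a b : Operand)
  | lt (a b : Operand)

/-- Programs. A program is a finite text that does not depend on the word length or on the input;
in particular it mentions only a constant number of registers. -/
inductive Program where
  | instr (i : Instr)
  | seq (p q : Program)
  | branch (b : Test) (p q : Program)
  | loop (b : Test) (p : Program)

/-- The read-only input: the words of the packed pattern and of the packed text. -/
structure Input (w : ℕ) where
  pat : ℕ → BitVec w
  txt : ℕ → BitVec w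

/-- A machine state: registers, working memory, and the words reported so far. -/
structure State (w : ℕ) where
  regs : ℕ → BitVec w
  mem : BitVec w → BitVec w
  out : List (BitVec w)

def Operand.eval {w : ℕ} (s : State w) : Operand → BitVec w
  | .reg i => s.regs i
  | .lit c => BitVec.ofNat w c

def Test.eval {w : ℕ} (s : State w) : Test → Prop
  | .eq a b => a.eval s = b.eval s
  | .lt a b => (a.eval s).toNat < (b.eval s).toNat

def State.setReg {w : ℕ} (s : State w) (d : ℕ) (v : BitVec w) : State w :=
  { s with regs := Function.update s.regs d v }

/-- The effect of one instruction on a machine whose working memory consists of the `S` words with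
addresses `0, …, S - 1`. An access to any other address of the working memory is an error (`none`):
the computation cannot be continued. -/
def Instr.eval {w : ℕ} (inp : Input w) (S : ℕ) (s : State w) : Instr → Option (State w)
  | .nop => some s
  | .move d a => some (s.setReg d (a.eval s))
  | .op o d a b => some (s.setReg d (o.eval (a.eval s) (b.eval s)))
  | .load d addr =>
      if (addr.eval s).toNat < S then some (s.setReg d (s.mem (addr.eval s))) else none
  | .store addr v =>
      if (addr.eval s).toNat < S then
        some { s with mem := Function.update s.mem (addr.eval s) (v.eval s) }
      else none
  | .readPat d idx => some (s.setReg d (inp.pat (idx.eval s).toNat))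
  | .readTxt d idx => some (s.setReg d (inp.txt (idx.eval s).toNat))
  | .report a => some { s with out := s.out ++ [a.eval s] }

/-- `Exec inp S p s T s'`: on the input `inp`, with `S` words of working memory, the program `p`
started in state `s` halts without error in state `s'` after exactly `T` steps. Every executed
instruction and every evaluated test is one step. -/
inductive Exec {w : ℕ} (inp : Input w) (S : ℕ) : Program → State w → ℕ → State w → Prop
  | instr {i : Instr} {s s' : State w} (h : i.eval inp S s = some s') :
      Exec inp S (.instr i) s 1 s'
  | seq {p q : Program} {s₁ s₂ s₃ : State w} {T₁ T₂ : ℕ}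
      (hp : Exec inp S p s₁ T₁ s₂) (hq : Exec inp S q s₂ T₂ s₃) :
      Exec inp S (.seq p q) s₁ (T₁ + T₂) s₃
  | branchTrue {b : Test} {p q : Program} {s s' : State w} {T : ℕ}
      (hb : b.eval s) (hp : Exec inp S p s T s') :
      Exec inp S (.branch b p q) s (T + 1) s'
  | branchFalse {b : Test} {p q : Program} {s s' : State w} {T : ℕ}
      (hb : ¬ b.eval s) (hq : Exec inp S q s T s') :
      Exec inp S (.branch b p q) s (T + 1) s'
  | loopTrue {b : Test} {p : Program} {s₁ s₂ s₃ : State w} {T₁ T₂ : ℕ}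
      (hb : b.eval s₁) (hp : Exec inp S p s₁ T₁ s₂) (hl : Exec inp S (.loop b p) s₂ T₂ s₃) :
      Exec inp S (.loop b p) s₁ (T₁ + T₂ + 1) s₃
  | loopFalse {b : Test} {p : Program} {s : State w} (hb : ¬ b.eval s) :
      Exec inp S (.loop b p) s 1 s

/-! ### Packed strings -/

/-- The number of bits of a character of an alphabet of size `σ`, that is `⌈log₂ σ⌉`. -/
def charBits (σ : ℕ) : ℕ := Nat.clog 2 σ

/-- The code of the character at position `i` (counted from `0`) of `A`; it is `0` past the end. -/
def charCode {σ : ℕ} (A : List (Fin σ)) (i : ℕ) : ℕ := ((A[i]?).map Fin.val).getD 0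

/-- The word number `x` of the packed representation of `A` with `k` characters per word: the
characters at positions `x * k, …, x * k + k - 1`, the first one in the least significant bits.
Unused bits are `0`, and so are all words past the last of the `⌈|A| / k⌉` words of `A`. -/
def packedWord (w k : ℕ) {σ : ℕ} (A : List (Fin σ)) (x : ℕ) : BitVec w :=
  BitVec.ofNat w (∑ j ∈ Finset.range k, charCode A (x * k + j) * 2 ^ (j * charBits σ))

/-- The input of the packed string matching problem. -/
def packedInput (w k : ℕ) {σ : ℕ} (P Q : List (Fin σ)) : Input w where
  pat := packedWord w k P
  txt := packedWord w k Q

/-- Initially registers `0` to `4` hold `|P|`, `|Q|`, the parameter `t`, the number of bits per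
character and the number of characters per word, all other registers are `0`, nothing has been
reported, and the content `mem` of the working memory is arbitrary. -/
def initState (w k t : ℕ) {σ : ℕ} (P Q : List (Fin σ)) (mem : BitVec w → BitVec w) : State w where
  regs
    | 0 => BitVec.ofNat w P.length
    | 1 => BitVec.ofNat w Q.length
    | 2 => BitVec.ofNat w t
    | 3 => BitVec.ofNat w (charBits σ)
    | 4 => BitVec.ofNat w k
    | _ => 0
  mem := mem
  out := []

/-! ### String matching -/

/-- The set of (starting) positions, counted from `0`, of the substrings of `Q` matching `P`. -/
def occurrences {σ : ℕ} (P Q : List (Fin σ)) : Finset ℕ :=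
  (Finset.range (Q.length + 1)).filter fun i => P <+: Q.drop i

/-- The reported words are exactly the occurrences of `P` in `Q`, each reported once. -/
def ReportsOccurrences {w σ : ℕ} (P Q : List (Fin σ)) (out : List (BitVec w)) : Prop :=
  out.Nodup ∧ ∀ i : ℕ, i ∈ out.map BitVec.toNat ↔ i ∈ occurrences P Q

end PackedMatching

/-! The text can be searched `q` positions at a time, where `q` is of order `log_σ t`: a table with
one entry per block of `3 * q` characters then has at most `t` entries, and such a block fits into a
word. If no `q ≥ 1` qualifies, or if `n = O(m + t)`, a character-by-character search is fast enough;
it is the same program with `q = 1` and an empty anchor.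

An anchor is a block of at most `2 * q` characters of the pattern for which false alarms are cheap:
if it is seen where an occurrence at `s` would put it, but the pattern does not occur at `s`, then
the pattern occurs at none of `s + 1, …, s + q - 1` (`IsAnchor`). A pattern shorter than `2 * q` is
its own anchor. Otherwise consider the periods `p < q` of the prefix of length `2 * q`. Without such
a period, two copies of this prefix are at distance at least `q` (`isAnchor_of_aperiodic`). If the
period breaks somewhere in the pattern, the block ending at the break cannot overlap itself at
distance less than `q` (`isAnchor_of_break`). If the whole pattern has period `p`, the prefix at `s`
and an occurrence shortly after `s` force an occurrence at `s` (`isAnchor_of_periodic`). The prefix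
table (Z-function) of the pattern, computed in time `O(m)`, distinguishes these cases.

For every block of `3 * q` characters the table gives the least shift below `q` at which the anchor
appears. A round of the search looks up one block: either `q` positions are ruled out, or a
candidate is found. The candidate is compared with the pattern `q` characters at a time, starting at
the right end of the last partial match; what lies before is decided by the prefix table. A failed
candidate rules out `q` positions by the anchor property, a successful one pays for its round. Hence
there are `O(n / q + occ)` rounds, and the full block comparisons number `O(n / q)` since the right
end never moves back (`wp_searchBody`). Maximality of `q` and `log_σ n ≤ a * k` bound `n / q` by
`O(n / log_σ t + m + t)` (`Mode.div_le`).

The program is verified in a logic of weakest preconditions with time credits (`WP`) over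
natural-number views of machine states. -/

namespace PackedMatching

/-! ### A small imperative language compiled to the word RAM

Expressions and loop-free commands are evaluated over natural numbers; the absence of overflow and
of invalid memory accesses is a proof obligation. Registers below `50` are program variables, the
others hold intermediate results. -/

/-- The part of a machine state that is visible to the program logic. -/
@[ext] structure View where
  r : ℕ → ℕ
  mem : ℕ → ℕ
  out : List ℕ

/-- Scratch registers read as `0`, so evaluating a compiled expression does not change the view. -/
def State.view {w : ℕ} (s : State w) : View where
  r i := if i < 50 then (s.regs i).toNat else 0
  mem a := if a < 2 ^ w then (s.mem (BitVec.ofNat w a)).toNat else 0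
  out := s.out.map BitVec.toNat

def View.set (v : View) (d x : ℕ) : View := { v with r := Function.update v.r d x }

inductive Expr where
  | reg (i : ℕ)
  | lit (c : ℕ)
  | bin (o : BinOp) (a b : Expr)
  | load (a : Expr)
  | pat (a : Expr)
  | txt (a : Expr)

/-- The values of the operations on natural numbers, in the absence of overflow. -/
def BinOp.val (w : ℕ) : BinOp → ℕ → ℕ → ℕ
  | .add, x, y => x + y
  | .sub, x, y => x - y
  | .mul, x, y => x * y
  | .div, x, y => x / y
  | .mod, x, y => x % y
  | .and, x, y => x &&& y
  | .or, x, y => x ||| y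
  | .xor, x, y => x ^^^ y
  | .shl, x, y => x * 2 ^ y % 2 ^ w
  | .shr, x, y => x / 2 ^ y

/-- The condition under which `BinOp.val` describes the operation of the machine. -/
def BinOp.ok (w : ℕ) : BinOp → ℕ → ℕ → Prop
  | .add, x, y => x + y < 2 ^ w
  | .sub, x, y => y ≤ x
  | .mul, x, y => x * y < 2 ^ w
  | _, _, _ => True

def Expr.val {w : ℕ} (inp : Input w) (v : View) : Expr → ℕ
  | .reg i => v.r i
  | .lit c => c
  | .bin o a b => o.val w (a.val inp v) (b.val inp v)
  | .load a => v.mem (a.val inp v)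
  | .pat a => (inp.pat (a.val inp v)).toNat
  | .txt a => (inp.txt (a.val inp v)).toNat

def Expr.ok {w : ℕ} (inp : Input w) (S : ℕ) (v : View) : Expr → Prop
  | .reg i => i < 50
  | .lit c => c < 2 ^ w
  | .bin o a b => a.ok inp S v ∧ b.ok inp S v ∧ o.ok w (a.val inp v) (b.val inp v)
  | .load a => a.ok inp S v ∧ a.val inp v < S
  | .pat a => a.ok inp S v
  | .txt a => a.ok inp S v

/-- The program that evaluates an expression into register `t`, changing only registers from `t`
on. -/
def Expr.compile : Expr → ℕ → Program
  | .reg i, t => .instr (.move t (.reg i))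
  | .lit c, t => .instr (.move t (.lit c))
  | .bin o a b, t =>
      .seq (a.compile t) (.seq (b.compile (t + 1)) (.instr (.op o t (.reg t) (.reg (t + 1)))))
  | .load a, t => .seq (a.compile t) (.instr (.load t (.reg t)))
  | .pat a, t => .seq (a.compile t) (.instr (.readPat t (.reg t)))
  | .txt a, t => .seq (a.compile t) (.instr (.readTxt t (.reg t)))

def Expr.cost : Expr → ℕ
  | .reg _ => 1
  | .lit _ => 1
  | .bin _ a b => a.cost + (b.cost + 1)
  | .load a => a.cost + 1
  | .pat a => a.cost + 1
  | .txt a => a.cost + 1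

/-! ### Correctness of compiled expressions and commands -/

theorem BinOp.toNat_eval {w : ℕ} (o : BinOp) (x y : BitVec w) (h : o.ok w x.toNat y.toNat) :
    (o.eval x y).toNat = o.val w x.toNat y.toNat := by
  have hx := x.isLt
  have hy := y.isLt
  cases o <;> simp only [BinOp.eval, BinOp.val, BinOp.ok] at *
  · rw [BitVec.toNat_add, Nat.mod_eq_of_lt h]
  · rw [BitVec.toNat_sub, show 2 ^ w - y.toNat + x.toNat = (x.toNat - y.toNat) + 2 ^ w by omega,
      Nat.add_mod_right, Nat.mod_eq_of_lt (by omega)]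
  · rw [BitVec.toNat_mul, Nat.mod_eq_of_lt h]
  · exact BitVec.toNat_udiv
  · exact BitVec.toNat_umod
  · exact BitVec.toNat_and x y
  · exact BitVec.toNat_or x y
  · exact BitVec.toNat_xor x y
  · rw [BitVec.toNat_shiftLeft, Nat.shiftLeft_eq]
  · rw [BitVec.toNat_ushiftRight, Nat.shiftRight_eq_div_pow]

theorem State.view_congr {w : ℕ} {s s' : State w} {t : ℕ} (ht : 50 ≤ t)
    (hr : ∀ j < t, s'.regs j = s.regs j) (hm : s'.mem = s.mem) (ho : s'.out = s.out) :
    s'.view = s.view := by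
  have : ∀ j, j < 50 → s'.regs j = s.regs j := fun j hj => hr j (by omega)
  ext i
  · simp only [State.view]; split_ifs with h
    · rw [this i h]
    · rfl
  · simp [State.view, hm]
  · simp [State.view, ho]

theorem State.setReg_regs {w : ℕ} (s : State w) (d : ℕ) (v : BitVec w) (j : ℕ) :
    (s.setReg d v).regs j = if j = d then v else s.regs j := by
  simp [State.setReg, Function.update_apply]

/-- The registers from `t` on serve as a stack: the second operand is evaluated from `t + 1` on and
so leaves the first one in `t` intact. -/
theorem Expr.exec_compile {w : ℕ} (inp : Input w) (S : ℕ) (e : Expr) :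
    ∀ (t : ℕ) (s : State w), 50 ≤ t → e.ok inp S s.view →
      ∃ s', Exec inp S (e.compile t) s e.cost s' ∧ (s'.regs t).toNat = e.val inp s.view ∧
        (∀ j < t, s'.regs j = s.regs j) ∧ s'.mem = s.mem ∧ s'.out = s.out := by
  induction e with
  | reg i =>
    intro t s ht hok
    refine ⟨_, .instr rfl, ?_, ?_, rfl, rfl⟩
    · have hi : i < 50 := hok
      simp [State.setReg_regs, Expr.val, State.view, Operand.eval, hi]
    · intro j hj; simp [State.setReg_regs, hj.ne]
  | lit c =>
    intro t s ht hok
    refine ⟨_, .instr rfl, ?_, ?_, rfl, rfl⟩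
    · have hi : c < 2 ^ w := hok
      simp [State.setReg_regs, Expr.val, Operand.eval, Nat.mod_eq_of_lt hi]
    · intro j hj; simp [State.setReg_regs, hj.ne]
  | bin o a b iha ihb =>
    intro t s ht ⟨hoa, hob, ho⟩
    obtain ⟨s₁, e₁, v₁, r₁, m₁, o₁⟩ := iha t s ht hoa
    have hv := State.view_congr ht r₁ m₁ o₁
    obtain ⟨s₂, e₂, v₂, r₂, m₂, o₂⟩ := ihb (t + 1) s₁ (by omega) (hv ▸ hob)
    rw [hv] at v₂
    have ht₂ := r₂ t (by omega)
    refine ⟨s₂.setReg t (o.eval (s₂.regs t) (s₂.regs (t + 1))), ?_, ?_, ?_, m₂.trans m₁,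
      o₂.trans o₁⟩
    · exact Exec.seq e₁ (.seq e₂ (.instr rfl))
    · simp only [State.setReg_regs, if_true, Expr.val]
      rw [BinOp.toNat_eval, ht₂, v₁, v₂]
      rw [ht₂, v₁, v₂]; exact ho
    · intro j hj
      rw [State.setReg_regs, if_neg hj.ne, r₂ j (by omega), r₁ j hj]
  | load a iha =>
    intro t s ht ⟨hoa, ho⟩
    obtain ⟨s₁, e₁, v₁, r₁, m₁, o₁⟩ := iha t s ht hoa
    refine ⟨s₁.setReg t (s₁.mem (s₁.regs t)), Exec.seq e₁ (.instr ?_), ?_, ?_, m₁, o₁⟩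
    · simp [Instr.eval, Operand.eval, v₁, ho]
    · have := (s₁.regs t).isLt
      rw [v₁] at this
      simp only [State.setReg_regs, if_true, Expr.val, State.view]
      rw [if_pos (by exact this), m₁]
      congr 2
      apply BitVec.eq_of_toNat_eq
      rw [v₁]; simp only [BitVec.toNat_ofNat]; rw [Nat.mod_eq_of_lt (by exact this)]; rfl
    · intro j hj; rw [State.setReg_regs, if_neg hj.ne, r₁ j hj]
  | pat a iha =>
    intro t s ht hoa
    obtain ⟨s₁, e₁, v₁, r₁, m₁, o₁⟩ := iha t s ht hoa
    refine ⟨_, Exec.seq e₁ (.instr rfl), ?_, ?_, m₁, o₁⟩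
    · simp [State.setReg_regs, Expr.val, Operand.eval, v₁]
    · intro j hj; rw [State.setReg_regs, if_neg hj.ne, r₁ j hj]
  | txt a iha =>
    intro t s ht hoa
    obtain ⟨s₁, e₁, v₁, r₁, m₁, o₁⟩ := iha t s ht hoa
    refine ⟨_, Exec.seq e₁ (.instr rfl), ?_, ?_, m₁, o₁⟩
    · simp [State.setReg_regs, Expr.val, Operand.eval, v₁]
    · intro j hj; rw [State.setReg_regs, if_neg hj.ne, r₁ j hj]

/-- Loop-free commands. -/
inductive Cmd where
  | asg (d : ℕ) (e : Expr)
  | store (a e : Expr)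
  | report (e : Expr)
  | seq (c c' : Cmd)
  | ifLt (a b : Expr) (c c' : Cmd)
  | ifEq (a b : Expr) (c c' : Cmd)

def Cmd.compile : Cmd → Program
  | .asg d e => .seq (e.compile 50) (.instr (.move d (.reg 50)))
  | .store a e => .seq (a.compile 50) (.seq (e.compile 51) (.instr (.store (.reg 50) (.reg 51))))
  | .report e => .seq (e.compile 50) (.instr (.report (.reg 50)))
  | .seq c c' => .seq c.compile c'.compile
  | .ifLt a b c c' => .seq (a.compile 50) (.seq (b.compile 51)
      (.branch (.lt (.reg 50) (.reg 51)) c.compile c'.compile))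
  | .ifEq a b c c' => .seq (a.compile 50) (.seq (b.compile 51)
      (.branch (.eq (.reg 50) (.reg 51)) c.compile c'.compile))

/-- An upper bound that adds the costs of both branches; being a closed numeral for each concrete
command, it can be computed. -/
def Cmd.cost : Cmd → ℕ
  | .asg _ e => e.cost + 1
  | .store a e => a.cost + e.cost + 1
  | .report e => e.cost + 1
  | .seq c c' => c.cost + c'.cost
  | .ifLt a b c c' => a.cost + b.cost + 1 + c.cost + c'.cost
  | .ifEq a b c c' => a.cost + b.cost + 1 + c.cost + c'.cost

/-- The weakest precondition of a loop-free command. -/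
def Cmd.vc {w : ℕ} (inp : Input w) (S : ℕ) : Cmd → (View → Prop) → View → Prop
  | .asg d e, Q, v => d < 50 ∧ e.ok inp S v ∧ Q (v.set d (e.val inp v))
  | .store a e, Q, v => a.ok inp S v ∧ e.ok inp S v ∧ a.val inp v < S ∧
      Q { v with mem := Function.update v.mem (a.val inp v) (e.val inp v) }
  | .report e, Q, v => e.ok inp S v ∧ Q { v with out := v.out ++ [e.val inp v] }
  | .seq c c', Q, v => c.vc inp S (c'.vc inp S Q) v
  | .ifLt a b c c', Q, v => a.ok inp S v ∧ b.ok inp S v ∧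
      (a.val inp v < b.val inp v → c.vc inp S Q v) ∧
      (b.val inp v ≤ a.val inp v → c'.vc inp S Q v)
  | .ifEq a b c c', Q, v => a.ok inp S v ∧ b.ok inp S v ∧
      (a.val inp v = b.val inp v → c.vc inp S Q v) ∧
      (a.val inp v ≠ b.val inp v → c'.vc inp S Q v)

theorem State.view_setReg {w : ℕ} (s : State w) {d : ℕ} (hd : d < 50) (x : BitVec w) :
    (s.setReg d x).view = s.view.set d x.toNat := by
  ext i
  · simp only [State.view, View.set, State.setReg_regs, Function.update_apply]
    split_ifs <;> first | rfl | omega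
  · rfl
  · rfl

theorem exec_pair {w : ℕ} {inp : Input w} {S : ℕ} {a b : Expr} {s : State w}
    (ha : a.ok inp S s.view) (hb : b.ok inp S s.view) :
    ∃ s₁ s₂, Exec inp S (a.compile 50) s a.cost s₁ ∧ Exec inp S (b.compile 51) s₁ b.cost s₂ ∧
      (s₂.regs 50).toNat = a.val inp s.view ∧ (s₂.regs 51).toNat = b.val inp s.view ∧
      s₂.view = s.view ∧ s₂.mem = s.mem := by
  obtain ⟨s₁, e₁, v₁, r₁, m₁, o₁⟩ := a.exec_compile inp S 50 s le_rfl ha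
  have hv := State.view_congr le_rfl r₁ m₁ o₁
  obtain ⟨s₂, e₂, v₂, r₂, m₂, o₂⟩ := b.exec_compile inp S 51 s₁ (by omega) (hv ▸ hb)
  have hv₂ := State.view_congr (by omega) r₂ m₂ o₂
  exact ⟨s₁, s₂, e₁, e₂, by rw [r₂ 50 (by omega), v₁], by rw [v₂, hv], hv₂.trans hv,
    m₂.trans m₁⟩

theorem Cmd.exec_compile {w : ℕ} (inp : Input w) (S : ℕ) (c : Cmd) :
    ∀ (Q : View → Prop) (s : State w), c.vc inp S Q s.view →
      ∃ T s', Exec inp S c.compile s T s' ∧ T ≤ c.cost ∧ Q s'.view := by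
  induction c with
  | asg d e =>
    intro Q s ⟨hd, ho, hQ⟩
    obtain ⟨s₁, e₁, v₁, r₁, m₁, o₁⟩ := e.exec_compile inp S 50 s le_rfl ho
    refine ⟨_, _, .seq e₁ (.instr rfl), by simp [Cmd.cost], ?_⟩
    rw [State.view_setReg _ hd, State.view_congr le_rfl r₁ m₁ o₁]
    simpa [Operand.eval, v₁] using hQ
  | store a e =>
    intro Q s ⟨hoa, hoe, hS, hQ⟩
    obtain ⟨s₁, s₂, e₁, e₂, v₁, v₂, hv, hm⟩ := exec_pair hoa hoe
    refine ⟨_, { s₂ with mem := Function.update s₂.mem (s₂.regs 50) (s₂.regs 51) },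
      .seq e₁ (.seq e₂ (.instr ?_)), by simp [Cmd.cost]; omega, ?_⟩
    · simp [Instr.eval, Operand.eval, v₁, hS]
    · convert hQ using 1
      have h1 : s₂.view.r = s.view.r := by rw [hv]
      have h2 : s₂.view.out = s.view.out := by rw [hv]
      have hlt := (s₂.regs 50).isLt
      ext i
      · exact congrFun h1 i
      · rw [← v₁, ← v₂]
        simp only [State.view, Function.update_apply, hm]
        by_cases hi : i < 2 ^ w
        · have : BitVec.ofNat w i = s₂.regs 50 ↔ i = (s₂.regs 50).toNat := by
            rw [← BitVec.toNat_inj, BitVec.toNat_ofNat, Nat.mod_eq_of_lt hi]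
          simp only [hi, if_true, this]; split_ifs <;> rfl
        · have : i ≠ (s₂.regs 50).toNat := by omega
          simp [hi, this]
      · simp only [← h2]; rfl
  | report e =>
    intro Q s ⟨ho, hQ⟩
    obtain ⟨s₁, e₁, v₁, r₁, m₁, o₁⟩ := e.exec_compile inp S 50 s le_rfl ho
    refine ⟨_, _, .seq e₁ (.instr rfl), by simp [Cmd.cost], ?_⟩
    convert hQ using 1
    have hv := State.view_congr le_rfl r₁ m₁ o₁
    rw [← v₁, ← hv]
    simp [State.view, Operand.eval]
  | seq c c' ih ih' =>
    intro Q s h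
    obtain ⟨T, s₁, e, hT, h⟩ := ih _ s h
    obtain ⟨T', s₂, e', hT', h⟩ := ih' _ s₁ h
    exact ⟨_, _, .seq e e', by simp [Cmd.cost]; omega, h⟩
  | ifLt a b c c' ih ih' =>
    intro Q s ⟨hoa, hob, h1, h2⟩
    obtain ⟨s₁, s₂, e₁, e₂, v₁, v₂, hv, hm⟩ := exec_pair hoa hob
    by_cases hlt : a.val inp s.view < b.val inp s.view
    · obtain ⟨T, s₃, e, hT, h⟩ := ih _ s₂ (hv ▸ h1 hlt)
      refine ⟨_, _, .seq e₁ (.seq e₂ (.branchTrue ?_ e)), by simp [Cmd.cost]; omega, h⟩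
      simpa [Test.eval, Operand.eval, v₁, v₂] using hlt
    · obtain ⟨T, s₃, e, hT, h⟩ := ih' _ s₂ (hv ▸ h2 (not_lt.1 hlt))
      refine ⟨_, _, .seq e₁ (.seq e₂ (.branchFalse ?_ e)), by simp [Cmd.cost]; omega, h⟩
      simpa [Test.eval, Operand.eval, v₁, v₂] using hlt
  | ifEq a b c c' ih ih' =>
    intro Q s ⟨hoa, hob, h1, h2⟩
    obtain ⟨s₁, s₂, e₁, e₂, v₁, v₂, hv, hm⟩ := exec_pair hoa hob
    by_cases hlt : a.val inp s.view = b.val inp s.view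
    · obtain ⟨T, s₃, e, hT, h⟩ := ih _ s₂ (hv ▸ h1 hlt)
      refine ⟨_, _, .seq e₁ (.seq e₂ (.branchTrue ?_ e)), by simp [Cmd.cost]; omega, h⟩
      simpa [Test.eval, Operand.eval, ← BitVec.toNat_inj, v₁, v₂] using hlt
    · obtain ⟨T, s₃, e, hT, h⟩ := ih' _ s₂ (hv ▸ h2 hlt)
      refine ⟨_, _, .seq e₁ (.seq e₂ (.branchFalse ?_ e)), by simp [Cmd.cost]; omega, h⟩
      simpa [Test.eval, Operand.eval, ← BitVec.toNat_inj, v₁, v₂] using hlt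

/-! ### Program logic with time credits -/

/-- Total correctness with time credits: from every state with view `v` and a budget of `n` steps,
`p` halts in a state that, together with the remaining budget, satisfies `Q`. -/
def WP {w : ℕ} (inp : Input w) (S : ℕ) (p : Program) (Q : View → ℕ → Prop) (v : View) (n : ℕ) :
    Prop :=
  ∀ s : State w, s.view = v → ∃ T s' n', Exec inp S p s T s' ∧ T + n' ≤ n ∧ Q s'.view n'

attribute [simp] Expr.val Expr.ok BinOp.val BinOp.ok Cmd.vc

@[simp] theorem View.set_r (v : View) (d x i : ℕ) :
    (v.set d x).r i = if i = d then x else v.r i := by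
  simp [View.set, Function.update_apply]

@[simp] theorem View.set_mem (v : View) (d x : ℕ) : (v.set d x).mem = v.mem := rfl

@[simp] theorem View.set_out (v : View) (d x : ℕ) : (v.set d x).out = v.out := rfl

variable {w : ℕ} {inp : Input w} {S : ℕ}

theorem WP.seq {p q : Program} {Q : View → ℕ → Prop} {v : View} {n : ℕ}
    (h : WP inp S p (WP inp S q Q) v n) : WP inp S (.seq p q) Q v n := by
  intro s hs
  obtain ⟨T, s₁, n₁, e, hT, h⟩ := h s hs
  obtain ⟨T', s₂, n₂, e', hT', h⟩ := h s₁ rfl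
  exact ⟨_, _, n₂, .seq e e', by omega, h⟩

theorem WP.mono {p : Program} {Q Q' : View → ℕ → Prop} {v : View} {n : ℕ}
    (h : WP inp S p Q v n) (hQ : ∀ v n, Q v n → Q' v n) : WP inp S p Q' v n := by
  intro s hs
  obtain ⟨T, s₁, n₁, e, hT, h⟩ := h s hs
  exact ⟨T, s₁, n₁, e, hT, hQ _ _ h⟩

theorem WP.cmd_of {c : Cmd} {P : View → Prop} {Q : View → ℕ → Prop} {v : View} (n K : ℕ) {N : ℕ}
    (hK : c.cost ≤ K) (hN : n + K ≤ N) (h : c.vc inp S P v) (hQ : ∀ v, P v → Q v n) :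
    WP inp S c.compile Q v N := by
  rintro s rfl
  obtain ⟨T, s₁, e, hT, h⟩ := c.exec_compile inp S _ s h
  exact ⟨T, s₁, n, e, by omega, hQ _ h⟩

theorem WP.cmd {c : Cmd} {Q : View → ℕ → Prop} {v : View} (n K : ℕ) {N : ℕ}
    (hK : c.cost ≤ K) (hN : n + K ≤ N) (h : c.vc inp S (fun v => Q v n) v) :
    WP inp S c.compile Q v N :=
  WP.cmd_of n K hK hN h fun _ h => h

/-- `while (reg a < reg b) p`. -/
def whileLt (a b : ℕ) (p : Program) : Program := .loop (.lt (.reg a) (.reg b)) p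

/-- Every evaluated test consumes a credit, so the remaining budget itself is the termination
measure. -/
theorem WP.whileLt {a b : ℕ} (ha : a < 50) (hb : b < 50) {p : Program} {Q I : View → ℕ → Prop}
    (hbody : ∀ v n, I v n → v.r a < v.r b → ∃ n', n' + 1 ≤ n ∧ WP inp S p I v n')
    (hexit : ∀ v n, I v n → v.r b ≤ v.r a → ∃ n', n' + 1 ≤ n ∧ Q v n') :
    ∀ (n : ℕ) (v : View), I v n → WP inp S (whileLt a b p) Q v n := by
  intro n
  induction n using Nat.strong_induction_on with
  | _ n ih =>
    rintro v hI s rfl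
    have key : Test.eval s (.lt (.reg a) (.reg b)) ↔ s.view.r a < s.view.r b := by
      simp [Test.eval, Operand.eval, State.view, ha, hb]
    by_cases h : s.view.r a < s.view.r b
    · obtain ⟨n', hn, hw⟩ := hbody _ _ hI h
      obtain ⟨T, s₁, n₁, e, hT, hI'⟩ := hw s rfl
      obtain ⟨T', s₂, n₂, e', hT', hQ⟩ := ih n₁ (by omega) _ hI' s₁ rfl
      exact ⟨_, _, n₂, .loopTrue (key.2 h) e e', by omega, hQ⟩
    · obtain ⟨n', hn, hw⟩ := hexit _ _ hI (not_lt.1 h)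
      exact ⟨_, _, n', .loopFalse (mt key.1 h), by omega, hw⟩

/-! ### Codes of blocks of characters -/

/-- The number whose base `2 ^ b` digits are `f i, …, f (i + c - 1)`. -/
def blockCode (b : ℕ) (f : ℕ → ℕ) (i c : ℕ) : ℕ := ∑ j ∈ Finset.range c, f (i + j) * 2 ^ (j * b)

theorem blockCode_add (b : ℕ) (f : ℕ → ℕ) (i c d : ℕ) :
    blockCode b f i (c + d) = blockCode b f i c + 2 ^ (c * b) * blockCode b f (i + c) d := by
  unfold blockCode
  rw [Finset.sum_range_add, Finset.mul_sum]
  congr 1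
  refine Finset.sum_congr rfl fun j _ => ?_
  rw [add_mul, pow_add, ← add_assoc]; ring

theorem blockCode_one (b : ℕ) (f : ℕ → ℕ) (i : ℕ) : blockCode b f i 1 = f i := by
  simp [blockCode]

section

variable {b : ℕ} {f g : ℕ → ℕ} (hf : ∀ i, f i < 2 ^ b) (hg : ∀ i, g i < 2 ^ b)

include hf in
theorem blockCode_lt (i c : ℕ) : blockCode b f i c < 2 ^ (c * b) := by
  induction c with
  | zero => simp [blockCode]
  | succ c ih =>
    rw [blockCode_add, blockCode_one]
    have := Nat.mul_le_mul_left (2 ^ (c * b)) (hf (i + c))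
    rw [add_mul, one_mul, pow_add]
    rw [Nat.succ_eq_add_one, mul_add, mul_one] at this
    omega

include hf in
theorem blockCode_mod (i : ℕ) {c c' : ℕ} (h : c' ≤ c) :
    blockCode b f i c % 2 ^ (c' * b) = blockCode b f i c' := by
  obtain ⟨d, rfl⟩ := Nat.exists_eq_add_of_le h
  rw [blockCode_add, Nat.add_mul_mod_self_left, Nat.mod_eq_of_lt (blockCode_lt hf i c')]

include hf in
theorem blockCode_div (i : ℕ) {c r : ℕ} (h : r ≤ c) :
    blockCode b f i c / 2 ^ (r * b) = blockCode b f (i + r) (c - r) := by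
  obtain ⟨d, rfl⟩ := Nat.exists_eq_add_of_le h
  rw [blockCode_add, Nat.add_mul_div_left _ _ (by positivity),
    Nat.div_eq_of_lt (blockCode_lt hf i r), zero_add, Nat.add_sub_cancel_left]

include hf hg in
theorem blockCode_inj (i i' c : ℕ) :
    blockCode b f i c = blockCode b g i' c ↔ ∀ j < c, f (i + j) = g (i' + j) := by
  constructor
  · intro h j hj
    have h1 : blockCode b f i c / 2 ^ (j * b) % 2 ^ (1 * b) =
        blockCode b g i' c / 2 ^ (j * b) % 2 ^ (1 * b) := by rw [h]
    rwa [blockCode_div hf _ hj.le, blockCode_div hg _ hj.le, blockCode_mod hf _ (by omega),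
      blockCode_mod hg _ (by omega), blockCode_one, blockCode_one] at h1
  · intro h
    exact Finset.sum_congr rfl fun j hj => by rw [h j (Finset.mem_range.1 hj)]

include hf in
/-- A block of at most `k` characters is obtained from two consecutive words of the packed
representation with `k` characters per word. -/
theorem blockCode_window {w k : ℕ} (hk : 1 ≤ k) (hw : k * b ≤ w) (p : ℕ) {c : ℕ} (hc : c ≤ k) :
    (blockCode b f (p / k * k) k / 2 ^ (p % k * b) |||
      blockCode b f ((p / k + 1) * k) k * 2 ^ ((k - p % k) * b) % 2 ^ w) %
        (1 * 2 ^ (c * b) % 2 ^ w) = blockCode b f p c := by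
  have hr : p % k < k := Nat.mod_lt _ hk
  have hp : p / k * k + p % k = p := Nat.div_add_mod' p k
  have hcw : c * b ≤ w := (Nat.mul_le_mul_right b hc).trans hw
  rw [blockCode_div hf _ hr.le, hp, show (p / k + 1) * k = p + (k - p % k) by
    rw [add_mul]; omega]
  set r := p % k
  have hA := blockCode_lt hf p (k - r)
  have hAw : blockCode b f p (k - r) < 2 ^ w :=
    hA.trans_le (Nat.pow_le_pow_right (by norm_num)
      ((Nat.mul_le_mul_right b (Nat.sub_le k r)).trans hw))
  set X := blockCode b f p (k - r) ||| blockCode b f (p + (k - r)) k * 2 ^ ((k - r) * b) % 2 ^ w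
    with hX
  -- The two words joined form the block of `2 * k - r` characters from `p` on, truncated to `w`
  -- bits; its lowest `c` characters survive because `c * b ≤ w`.
  have hX2 : X = blockCode b f p (k - r + k) % 2 ^ w := by
    rw [hX]
    conv_lhs => rw [← Nat.mod_eq_of_lt hAw]
    rw [← Nat.or_mod_two_pow, blockCode_add, Nat.add_comm (blockCode b f p (k - r)),
      Nat.two_pow_add_eq_or_of_lt hA, mul_comm (2 ^ _), Nat.or_comm]
  have hmod : X % (1 * 2 ^ (c * b) % 2 ^ w) = X % 2 ^ (c * b) := by
    rw [one_mul]
    rcases hcw.eq_or_lt with h | h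
    -- If the block fills the whole word, the shifted `1` overflows to `0`; reduction modulo `0` is
    -- the identity, here as on the machine.
    · rw [h, Nat.mod_self, Nat.mod_zero, Nat.mod_eq_of_lt (hX2 ▸ Nat.mod_lt _ (by positivity))]
    · rw [Nat.mod_eq_of_lt (Nat.pow_lt_pow_right (by norm_num) h)]
  rw [hmod, hX2, Nat.mod_mod_of_dvd _ (pow_dvd_pow 2 hcw), blockCode_mod hf _ (by omega)]

end

/-! ### Prefix tables, anchors and shifts -/

/-- The pattern `g` of length `m` occurs at position `s` of `f`. -/
def MatchAt (f g : ℕ → ℕ) (m s : ℕ) : Prop := ∀ j < m, f (s + j) = g j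

/-- `z` is the length of the longest common prefix of `g` and its suffix starting at `d`. -/
structure IsPrefixLen (g : ℕ → ℕ) (m d z : ℕ) : Prop where
  le : d + z ≤ m
  agree : ∀ j < z, g (d + j) = g j
  differ : d + z < m → g (d + z) ≠ g z

/-- Whenever the block of `l` characters of `g` at offset `o` is found where an occurrence at `s`
would have it, but `g` does not occur at `s`, there is no occurrence at distance less than `q`
after `s`. -/
structure IsAnchor (g : ℕ → ℕ) (m q o l : ℕ) : Prop where
  le : o + l ≤ m
  skip : ∀ (f : ℕ → ℕ) (s : ℕ), (∀ j < l, f (s + o + j) = g (o + j)) → ¬ MatchAt f g m s →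
    ∀ d, 0 < d → d < q → ¬ MatchAt f g m (s + d)

theorem isAnchor_one (g : ℕ → ℕ) (m : ℕ) : IsAnchor g m 1 0 0 :=
  ⟨by omega, fun _ _ _ _ d h1 h2 => by omega⟩

theorem isAnchor_self (g : ℕ → ℕ) (m q : ℕ) : IsAnchor g m q 0 m := by
  refine ⟨by omega, fun f s h h' => absurd (fun j hj => ?_) h'⟩
  simpa using h j hj

/-! ### Anchors from the periodicity of the pattern -/

/-- An occurrence at distance `d` would make the prefix of length `2 * q` agree with its own shift
by `d`, but the prefix table shows a mismatch inside it. -/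
theorem isAnchor_of_aperiodic {g : ℕ → ℕ} {m q : ℕ} {Z : ℕ → ℕ} (hq : 2 * q ≤ m)
    (hZ : ∀ d < m, IsPrefixLen g m d (Z d)) (h : ∀ p, 0 < p → p < q → p + Z p < 2 * q) :
    IsAnchor g m q 0 (2 * q) := by
  refine ⟨by omega, fun f s h1 _ d hd hdq h2 => ?_⟩
  have hz := hZ d (by omega)
  have hlt := h d hd hdq
  refine hz.differ (by omega) ?_
  have e1 := h1 (d + Z d) (by omega)
  have e2 := h2 (Z d) (by omega)
  simp only [add_zero, zero_add, ← add_assoc] at e1 e2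
  rw [← e1, e2]

/-- The block ends exactly at the character that breaks the period `p`. As `p + d ≤ 2 * q - 2`, the
block is long enough to go from its last character by `d`, then `p`, and back by `d`, which would
restore the period at the break. -/
theorem isAnchor_of_break {g : ℕ → ℕ} {m q p z : ℕ} (hp : p < q)
    (hz : IsPrefixLen g m p z) (h : 2 * q ≤ p + z) (hm : p + z < m) :
    IsAnchor g m q (p + z + 1 - 2 * q) (2 * q) := by
  refine ⟨by omega, fun f s h1 _ d hd hdq h2 => ?_⟩
  -- the block would have period `d`, and without its last character it has period `p`
  have per : ∀ x, p + z + 1 - 2 * q ≤ x → x + d ≤ p + z → g (x + d) = g x := by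
    intro x hx hxd
    have e1 := h1 (x + d - (p + z + 1 - 2 * q)) (by omega)
    have e2 := h2 x (by omega)
    rw [show p + z + 1 - 2 * q + (x + d - (p + z + 1 - 2 * q)) = x + d by omega,
      show s + (p + z + 1 - 2 * q) + (x + d - (p + z + 1 - 2 * q)) = s + d + x by omega] at e1
    rw [← e1, e2]
  have e1 := per (p + z - d) (by omega) (by omega)
  have e2 := hz.agree (z - d) (by omega)
  have e3 := per (z - d) (by omega) (by omega)
  rw [show p + z - d + d = p + z by omega] at e1
  rw [show p + (z - d) = p + z - d by omega] at e2
  rw [show z - d + d = z by omega] at e3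
  exact hz.differ hm (by rw [e1, e2, e3])

/-- Beyond the anchor, position `j` of a would-be occurrence at `s` is also covered by the
occurrence at `s + d`; the period `p` of the pattern reduces it to position `j - p`, hence the
strong induction. -/
theorem isAnchor_of_periodic {g : ℕ → ℕ} {m q p z : ℕ} (hp0 : 0 < p) (hp : p < q)
    (hz : IsPrefixLen g m p z) (h : 2 * q ≤ p + z) (hm : p + z = m) :
    IsAnchor g m q 0 (2 * q) := by
  refine ⟨by omega, fun f s h1 h3 d hd hdq h2 => h3 ?_⟩
  intro j
  induction j using Nat.strong_induction_on with
  | _ j ih =>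
    intro hj
    by_cases hj2 : j < 2 * q
    · simpa using h1 j hj2
    · have e1 := h2 (j - d) (by omega)
      have e2 := hz.agree (j - d - p) (by omega)
      have e3 := h2 (j - d - p) (by omega)
      have e4 := ih (j - p) (by omega) (by omega)
      have e5 := hz.agree (j - p) (by omega)
      rw [show s + d + (j - d) = s + j by omega] at e1
      rw [show p + (j - d - p) = j - d by omega] at e2
      rw [show s + d + (j - d - p) = s + (j - p) by omega] at e3
      rw [show p + (j - p) = j by omega] at e5
      rw [e1, e2, ← e3, e4, e5]

/-! ### Reuse of a partial match through the prefix table -/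

/-- Inside the box the string repeats its own prefix, so the answer for `i - l` can be copied. The
strict bound on `z` keeps the mismatch inside the box. -/
theorem IsPrefixLen.of_box {g : ℕ → ℕ} {m l r i z : ℕ} (hli : l ≤ i)
    (hbox : ∀ x, l + x < r → g (l + x) = g x) (hr : r ≤ m)
    (hz : IsPrefixLen g m (i - l) z) (h : z < r - i) : IsPrefixLen g m i z := by
  refine ⟨by omega, fun j hj => ?_, fun _ => ?_⟩
  · have e1 := hbox (i - l + j) (by omega)
    rw [show l + (i - l + j) = i + j by omega] at e1
    rw [e1, hz.agree j hj]
  · have e1 := hbox (i - l + z) (by omega)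
    rw [show l + (i - l + z) = i + z by omega] at e1
    rw [e1]
    exact hz.differ (by omega)

/-- A partial match at `l` is also one at a later position `i` unless the prefix table shows a
mismatch. -/
theorem box_shift {f g : ℕ → ℕ} {m l r i z : ℕ} (hli : l ≤ i)
    (hbox : ∀ x, l + x < r → f (l + x) = g x) (hz : IsPrefixLen g m (i - l) z) (h : r - i ≤ z) :
    ∀ x, i + x < r → f (i + x) = g x := by
  intro x hx
  have e1 := hbox (i - l + x) (by omega)
  rw [show l + (i - l + x) = i + x by omega] at e1
  rw [e1, hz.agree x (by omega)]

theorem not_matchAt_of_box {f g : ℕ → ℕ} {m l r i z : ℕ} (hli : l ≤ i) (hr : r ≤ l + m)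
    (hbox : ∀ x, l + x < r → f (l + x) = g x) (hz : IsPrefixLen g m (i - l) z) (h : z < r - i) :
    ¬ MatchAt f g m i := by
  intro hm
  have e1 := hbox (i - l + z) (by omega)
  rw [show l + (i - l + z) = i + z by omega] at e1
  have e2 := hm z (by omega)
  exact hz.differ (by omega) (by rw [← e1, e2])

/-- `d` is the least shift below `q` at which the lowest digits of `c` are those of `u`, and `q` if
there is none. -/
structure IsShift (b q l u c d : ℕ) : Prop where
  le : d ≤ q
  ne : ∀ e < d, c / 2 ^ (e * b) % 2 ^ (l * b) ≠ u
  eq : d < q → c / 2 ^ (d * b) % 2 ^ (l * b) = u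

theorem IsShift.of_eq {b q l u c : ℕ} (h : c % 2 ^ (l * b) = u) : IsShift b q l u c 0 :=
  ⟨by omega, by simp, fun _ => by simpa using h⟩

theorem isShift_zero {b q l u : ℕ} (h : u ≠ 0) : IsShift b q l u 0 q :=
  ⟨le_rfl, by simpa using fun _ _ => h.symm, by simp⟩

/-- Dividing by `2 ^ b` drops the first character, so the entry of `c` comes from that of a smaller
code. If `d + 1 = q`, the value already means that no shift below `q` works. -/
theorem IsShift.step {b q l u c d : ℕ} (h : c % 2 ^ (l * b) ≠ u)
    (hd : IsShift b q l u (c / 2 ^ b) d) : IsShift b q l u c (if d < q then d + 1 else q) := by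
  have key : ∀ e, c / 2 ^ b / 2 ^ (e * b) = c / 2 ^ ((e + 1) * b) := by
    intro e; rw [Nat.div_div_eq_div_mul, ← pow_add]; congr 2; ring
  have hne : ∀ e ≤ d, c / 2 ^ (e * b) % 2 ^ (l * b) ≠ u := by
    intro e he
    rcases e with _ | e
    · simpa using h
    · rw [← key]; exact hd.ne e (by omega)
  split_ifs with hq
  · exact ⟨hq, fun e he => hne e (by omega), fun _ => by rw [← key]; exact hd.eq hq⟩
  · have := hd.le
    exact ⟨le_rfl, fun e he => hne e (by omega), by simp⟩

/-! ### Setting and notation of the matching program -/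

instance : Add Expr := ⟨.bin .add⟩
instance : Sub Expr := ⟨.bin .sub⟩
instance : Mul Expr := ⟨.bin .mul⟩
instance : Div Expr := ⟨.bin .div⟩
instance : Mod Expr := ⟨.bin .mod⟩

@[simp] theorem Expr.add_def (a b : Expr) : a + b = .bin .add a b := rfl
@[simp] theorem Expr.sub_def (a b : Expr) : a - b = .bin .sub a b := rfl
@[simp] theorem Expr.mul_def (a b : Expr) : a * b = .bin .mul a b := rfl
@[simp] theorem Expr.div_def (a b : Expr) : a / b = .bin .div a b := rfl
@[simp] theorem Expr.mod_def (a b : Expr) : a % b = .bin .mod a b := rfl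

abbrev Expr.shl (a b : Expr) : Expr := .bin .shl a b
abbrev Expr.shr (a b : Expr) : Expr := .bin .shr a b

/-- The input of the matching problem in terms of character codes `f` (text) and `g` (pattern). -/
structure Setting {w : ℕ} (inp : Input w) (S k b m n t : ℕ) (f g : ℕ → ℕ) : Prop where
  b_pos : 1 ≤ b
  k_pos : 1 ≤ k
  fits : k * b ≤ w
  m_le : m ≤ n
  n_lt : n < 2 ^ w
  t_ge : 2 ≤ t
  t_lt : t < 2 ^ w
  space : t + m ≤ S
  f_lt : ∀ i, f i < 2 ^ b
  g_lt : ∀ i, g i < 2 ^ b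
  txt : ∀ x, (inp.txt x).toNat = blockCode b f (x * k) k
  pat : ∀ x, (inp.pat x).toNat = blockCode b g (x * k) k

/-- The registers that hold the parameters of the problem. -/
structure Holds (v : View) (k b m n t : ℕ) : Prop where
  r0 : v.r 0 = m
  r1 : v.r 1 = n
  r2 : v.r 2 = t
  r3 : v.r 3 = b
  r4 : v.r 4 = k

@[simp] theorem holds_set {v : View} {k b m n t d x : ℕ} (hd : 5 ≤ d) :
    Holds (v.set d x) k b m n t ↔ Holds v k b m n t := by
  constructor <;> rintro ⟨h0, h1, h2, h3, h4⟩ <;> constructor <;>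
    simp_all [show 0 ≠ d by omega, show 1 ≠ d by omega, show 2 ≠ d by omega,
      show 3 ≠ d by omega, show 4 ≠ d by omega]

/-- The code of the block of `c` characters at position `p` of the string read by `rd`. -/
def window (rd : Expr → Expr) (p c : Expr) : Expr :=
  .bin .mod
    (.bin .or ((rd (p / .reg 4)).shr (p % .reg 4 * .reg 3))
      ((rd (p / .reg 4 + .lit 1)).shl ((.reg 4 - p % .reg 4) * .reg 3)))
    ((Expr.lit 1).shl (c * .reg 3))

section

variable {w : ℕ} {inp : Input w} {S k b m n t : ℕ} {f g : ℕ → ℕ}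

/-- Makes the literals up to `3` representable; larger literals are avoided in the program since `w
= 2` is possible. -/
theorem Setting.four_le (H : Setting inp S k b m n t f g) : 4 ≤ 2 ^ w := by
  have h1 := H.t_ge
  have h2 := H.t_lt
  rcases w with _ | _ | w
  · simp at h2; omega
  · simp at h2; omega
  · rw [pow_add]; have := Nat.one_le_two_pow (n := w); omega

theorem Setting.w_ne (H : Setting inp S k b m n t f g) : w ≠ 0 := by
  rintro rfl
  have := H.four_le
  omega

variable {v : View} {p c : Expr}

theorem val_window_txt (H : Setting inp S k b m n t f g) (h3 : v.r 3 = b) (h4 : v.r 4 = k)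
    (hc : c.val inp v ≤ k) :
    (window .txt p c).val inp v = blockCode b f (p.val inp v) (c.val inp v) := by
  rw [← blockCode_window H.f_lt H.k_pos H.fits (p.val inp v) hc]
  simp only [window, Expr.add_def, Expr.sub_def, Expr.mul_def, Expr.div_def, Expr.mod_def,
    Expr.val, BinOp.val, h3, h4, H.txt]

theorem val_window_pat (H : Setting inp S k b m n t f g) (h3 : v.r 3 = b) (h4 : v.r 4 = k)
    (hc : c.val inp v ≤ k) :
    (window .pat p c).val inp v = blockCode b g (p.val inp v) (c.val inp v) := by
  rw [← blockCode_window H.g_lt H.k_pos H.fits (p.val inp v) hc]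
  simp only [window, Expr.add_def, Expr.sub_def, Expr.mul_def, Expr.div_def, Expr.mod_def,
    Expr.val, BinOp.val, h3, h4, H.pat]

theorem ok_window {rd : Expr → Expr} (hrd : rd = .txt ∨ rd = .pat)
    (H : Setting inp S k b m n t f g) (h3 : v.r 3 = b) (h4 : v.r 4 = k)
    (hc : c.val inp v ≤ k) : (window rd p c).ok inp S v ↔
      p.ok inp S v ∧ c.ok inp S v ∧ p.val inp v / k + 1 < 2 ^ w := by
  have h2w := H.four_le
  have hw : w < 2 ^ w := Nat.lt_two_pow_self
  have e1 : p.val inp v % k < k := Nat.mod_lt _ H.k_pos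
  have e2 : p.val inp v % k * b < 2 ^ w :=
    ((Nat.mul_le_mul_right b e1.le).trans H.fits).trans_lt hw
  have e3 : (k - p.val inp v % k) * b < 2 ^ w :=
    ((Nat.mul_le_mul_right b (Nat.sub_le _ _)).trans H.fits).trans_lt hw
  have e4 : c.val inp v * b < 2 ^ w := ((Nat.mul_le_mul_right b hc).trans H.fits).trans_lt hw
  have e5 : 1 < 2 ^ w := by omega
  rcases hrd with rfl | rfl <;>
  · simp [window, h3, h4, e1.le, e2, e3, e4, e5]
    tauto

theorem ok_window_txt (H : Setting inp S k b m n t f g) (h3 : v.r 3 = b) (h4 : v.r 4 = k)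
    (hc : c.val inp v ≤ k) : (window .txt p c).ok inp S v ↔
      p.ok inp S v ∧ c.ok inp S v ∧ p.val inp v / k + 1 < 2 ^ w :=
  ok_window (.inl rfl) H h3 h4 hc

theorem ok_window_pat (H : Setting inp S k b m n t f g) (h3 : v.r 3 = b) (h4 : v.r 4 = k)
    (hc : c.val inp v ≤ k) : (window .pat p c).ok inp S v ↔
      p.ok inp S v ∧ c.ok inp S v ∧ p.val inp v / k + 1 < 2 ^ w :=
  ok_window (.inr rfl) H h3 h4 hc

end

/-! ### Choosing the block length

Register `5` receives the block length `q`, register `6` tells whether the table is used, register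
`7` receives the size `2 ^ (3 * q * b)` of the table. -/

/-- The parameters of the search: either blocks of `3 * q` characters index a table of size at most
`t`, or the text is scanned character by character. -/
inductive Mode (k b m n t : ℕ) : ℕ → ℕ → Prop
  | table {q : ℕ} (hq : 1 ≤ q) (hk : 3 * q ≤ k) (ht : 2 ^ (3 * q * b) ≤ t)
      (hmax : k < 3 * (q + 1) ∨ t < 2 ^ (3 * (q + 1) * b)) (hmn : 4 * m < n) (htn : 4 * t < n) :
      Mode k b m n t q 1
  | scan (h : n ≤ 4 * m + 3 ∨ n ≤ 4 * t + 3 ∨ k < 3 ∨ t < 2 ^ (3 * b)) : Mode k b m n t 1 0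

/-- With the bound `t / 2 ^ (3 * b) + 1`, the loop test `2 ^ (3 * q * b) < t / 2 ^ (3 * b) + 1`
decides whether `2 ^ (3 * (q + 1) * b) ≤ t` before that power is formed. Three shifts by `b` are
used because `3 * b` may overflow. -/
def chooseInit : Cmd :=
  .seq (.asg 5 (.lit 0)) <|
  .seq (.asg 7 (.lit 1)) <|
  .asg 11 ((((Expr.reg 2).shr (.reg 3)).shr (.reg 3)).shr (.reg 3) + .lit 1)

def chooseStep : Cmd :=
  .seq (.asg 5 (.reg 5 + .lit 1)) <|
  .asg 7 ((Expr.lit 1).shl (.lit 3 * .reg 5 * .reg 3))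

/-- The second branch is a placeholder: register `6` is set afresh by `chooseMode`. -/
def chooseCap : Cmd :=
  .ifLt (.reg 4 / .lit 3) (.reg 5) (.asg 5 (.reg 4 / .lit 3)) (.asg 6 (.lit 0))

def chooseMode : Cmd :=
  .seq (.asg 7 ((Expr.lit 1).shl (.lit 3 * .reg 5 * .reg 3))) <|
  .seq (.ifLt (.reg 0) ((Expr.reg 1).shr (.lit 2))
    (.ifLt (.reg 2) ((Expr.reg 1).shr (.lit 2))
      (.ifLt (.lit 0) (.reg 5) (.asg 6 (.lit 1)) (.asg 6 (.lit 0)))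
      (.asg 6 (.lit 0)))
    (.asg 6 (.lit 0))) <|
  .ifEq (.reg 6) (.lit 0) (.asg 5 (.lit 1)) (.asg 6 (.lit 1))

def choosePhase : Program :=
  .seq chooseInit.compile (.seq (whileLt 7 11 chooseStep.compile)
    (.seq chooseCap.compile chooseMode.compile))

structure Chosen (v : View) (k b m n t q μ : ℕ) : Prop extends Holds v k b m n t where
  r5 : v.r 5 = q
  r6 : v.r 6 = μ
  r7 : μ = 1 → v.r 7 = 2 ^ (3 * q * b)

section

variable {w : ℕ} {inp : Input w} {S k b m n t : ℕ} {f g : ℕ → ℕ}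

theorem wp_chooseInit (H : Setting inp S k b m n t f g) {v : View} (hv : Holds v k b m n t)
    (ho : v.out = [])
    {N : ℕ} : WP inp S chooseInit.compile
      (fun v n' => Holds v k b m n t ∧ v.out = [] ∧ v.r 5 = 0 ∧ v.r 7 = 1 ∧
        v.r 11 = t / 2 ^ b / 2 ^ b / 2 ^ b + 1 ∧ n' = N) v (N + 20) := by
  refine WP.cmd N 20 (by decide) le_rfl ?_
  have h2w := H.four_le
  have h2 : t / 2 ^ b / 2 ^ b / 2 ^ b < t := by
    refine ((Nat.div_le_self _ _).trans (Nat.div_le_self _ _)).trans_lt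
      (Nat.div_lt_self (by have := H.t_ge; omega) (Nat.one_lt_two_pow (by have := H.b_pos; omega)))
  have h3 := H.t_lt
  have h4 : t / 2 ^ b / 2 ^ b / 2 ^ b + 1 < 2 ^ w := by exact lt_of_le_of_lt h2 h3
  simp [chooseInit, hv, ho, hv.r2, hv.r3, H.w_ne, h4]

theorem wp_chooseLoop (H : Setting inp S k b m n t f g) {v : View} (hv : Holds v k b m n t)
    (ho : v.out = [])
    (h5 : v.r 5 = 0) (h7 : v.r 7 = 1) (h11 : v.r 11 = t / 2 ^ b / 2 ^ b / 2 ^ b + 1) {N : ℕ} :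
    WP inp S (whileLt 7 11 chooseStep.compile)
      (fun v n' => Holds v k b m n t ∧ v.out = [] ∧ 2 ^ (3 * v.r 5 * b) ≤ t ∧
        t < 2 ^ (3 * (v.r 5 + 1) * b) ∧ n' = N) v (N + 30 * t + 1) := by
  have h2w := H.four_le
  have hbt := H.t_lt
  have hb := H.b_pos
  have pow3 : ∀ q, 2 ^ (3 * (q + 1) * b) = 2 ^ (3 * q * b) * (2 ^ b * 2 ^ b * 2 ^ b) := by
    intro q; rw [← pow_add, ← pow_add, ← pow_add]; congr 1; ring
  have hdiv : t / 2 ^ b / 2 ^ b / 2 ^ b = t / (2 ^ b * 2 ^ b * 2 ^ b) := by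
    rw [Nat.div_div_eq_div_mul, Nat.div_div_eq_div_mul, mul_assoc]
  refine WP.whileLt (by norm_num) (by norm_num)
    -- At most `t` iterations occur, since `3 * q * b < 2 ^ (3 * q * b) ≤ t`.
    (I := fun v n' => Holds v k b m n t ∧ v.out = [] ∧ v.r 7 = 2 ^ (3 * v.r 5 * b) ∧ v.r 7 ≤ t ∧
      v.r 11 = t / 2 ^ b / 2 ^ b / 2 ^ b + 1 ∧ v.r 5 < t ∧ N + 30 * (t - v.r 5) + 1 ≤ n') ?_ ?_ _ _
      ⟨hv, ho, by simp [h5, h7], by have := H.t_ge; omega, h11, by have := H.t_ge; omega,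
        by rw [h5]; omega⟩
  · rintro v n' ⟨hv, ho, h7, h7t, h11, h5, hn'⟩ hlt
    rw [h7, h11, hdiv, Nat.lt_succ_iff, Nat.le_div_iff_mul_le (by positivity), ← pow3] at hlt
    have hq : 3 * (v.r 5 + 1) * b < w :=
      (Nat.pow_lt_pow_iff_right (a := 2) (by norm_num)).1 (hlt.trans_lt H.t_lt)
    have hw : w < 2 ^ w := Nat.lt_two_pow_self
    have hqb : 3 * (v.r 5 + 1) ≤ 3 * (v.r 5 + 1) * b := Nat.le_mul_of_pos_right _ hb
    have hqt : 3 * (v.r 5 + 1) * b < t := Nat.lt_two_pow_self.trans_le hlt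
    refine ⟨n' - 1, by omega, WP.cmd (n' - 30) 29 (by decide) (by omega) ?_⟩
    simp [chooseStep, hv, ho, hv.r3, Nat.mod_eq_of_lt (hlt.trans_lt H.t_lt)]
    omega
  · rintro v n' ⟨hv, ho, h7, h7t, h11, h5, hn'⟩ hle
    rw [h7, h11, hdiv, Nat.succ_le_iff, Nat.div_lt_iff_lt_mul (by positivity), ← pow3] at hle
    refine ⟨N, by omega, hv, ho, by omega, hle, rfl⟩

theorem wp_chooseCap (H : Setting inp S k b m n t f g) {v : View} (hv : Holds v k b m n t)
    (ho : v.out = [])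
    (h1 : 2 ^ (3 * v.r 5 * b) ≤ t) (h2 : t < 2 ^ (3 * (v.r 5 + 1) * b)) {N : ℕ} :
    WP inp S chooseCap.compile
      (fun v n' => Holds v k b m n t ∧ v.out = [] ∧ 3 * v.r 5 ≤ k ∧ 2 ^ (3 * v.r 5 * b) ≤ t ∧
        (k < 3 * (v.r 5 + 1) ∨ t < 2 ^ (3 * (v.r 5 + 1) * b)) ∧ n' = N) v (N + 20) := by
  have h2w := H.four_le
  refine WP.cmd N 20 (by decide) le_rfl ?_
  simp only [chooseCap, Cmd.vc, Expr.val, Expr.ok, BinOp.val, BinOp.ok, Expr.div_def, View.set_r,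
    hv.r4]
  refine ⟨by norm_num; omega, by norm_num, fun h => ⟨by norm_num, by norm_num; omega, ?_⟩,
    fun h => ⟨by norm_num, by omega, ?_⟩⟩
  · refine ⟨(holds_set (by norm_num)).2 hv, ho, ?_, ?_, ?_, trivial⟩ <;> simp only [if_true]
    · omega
    · refine le_trans (Nat.pow_le_pow_right (by norm_num) (Nat.mul_le_mul_right b ?_)) h1
      omega
    · left; omega
  · refine ⟨(holds_set (by norm_num)).2 hv, ho, ?_, ?_, ?_, trivial⟩ <;> simp
    · omega
    · exact h1
    · exact .inr h2

theorem wp_chooseMode (H : Setting inp S k b m n t f g) {v : View} (hv : Holds v k b m n t)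
    (ho : v.out = [])
    (hk : 3 * v.r 5 ≤ k) (ht : 2 ^ (3 * v.r 5 * b) ≤ t)
    (hmax : k < 3 * (v.r 5 + 1) ∨ t < 2 ^ (3 * (v.r 5 + 1) * b)) {N : ℕ} :
    WP inp S chooseMode.compile
      (fun v n' => (∃ q μ, Mode k b m n t q μ ∧ Chosen v k b m n t q μ) ∧ v.out = [] ∧ n' = N) v
      (N + 50) := by
  have h2w := H.four_le
  have hw : w < 2 ^ w := Nat.lt_two_pow_self
  have hkb : 3 * v.r 5 * b ≤ w := (Nat.mul_le_mul_right b hk).trans H.fits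
  have hqb : 3 * v.r 5 ≤ 3 * v.r 5 * b := Nat.le_mul_of_pos_right _ H.b_pos
  refine WP.cmd N 50 (by decide) le_rfl ?_
  simp [chooseMode, hv.r0, hv.r1, hv.r2, hv.r3, ho,
    Nat.mod_eq_of_lt (ht.trans_lt H.t_lt), H.w_ne]
  refine ⟨⟨⟨by omega, by omega⟩, by omega⟩, by omega, fun hm => ⟨by omega, fun h => ⟨fun hq => ?_,
    fun hq => ?_⟩, fun h => ?_⟩, fun hm => ?_⟩
  · refine ⟨_, _, .table hq hk ht hmax (by omega) (by omega), ?_⟩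
    constructor <;> simp [hv]
  all_goals
    refine ⟨_, _, .scan ?_, ?_⟩
    rotate_left
    · constructor <;> simp [hv]
  · rw [hq] at hmax; simp at hmax; omega
  · omega
  · omega

theorem wp_choose (H : Setting inp S k b m n t f g) {v : View} (hv : Holds v k b m n t)
    (ho : v.out = []) {N : ℕ} :
    WP inp S choosePhase
      (fun v n' => (∃ q μ, Mode k b m n t q μ ∧ Chosen v k b m n t q μ) ∧ v.out = [] ∧ n' = N) v
      (N + 30 * t + 91) := by
  refine WP.seq ((wp_chooseInit H hv ho (N := N + 30 * t + 71)).mono ?_)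
  rintro v _ ⟨hv, ho, h5, h7, h11, rfl⟩
  rw [show N + 30 * t + 71 = N + 70 + 30 * t + 1 by omega]
  refine WP.seq ((wp_chooseLoop H hv ho h5 h7 h11).mono ?_)
  rintro v _ ⟨hv, ho, h1, h2, rfl⟩
  refine WP.seq ((wp_chooseCap H hv ho h1 h2 (N := N + 50)).mono ?_)
  rintro v _ ⟨hv, ho, h1, h2, h3, rfl⟩
  exact wp_chooseMode H hv ho h1 h2 h3

end

@[simp] theorem holds_mk {v : View} {M : ℕ → ℕ} {O : List ℕ} {k b m n t : ℕ} :
    Holds ⟨v.r, M, O⟩ k b m n t ↔ Holds v k b m n t := by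
  constructor <;> rintro ⟨h0, h1, h2, h3, h4⟩ <;> exact ⟨h0, h1, h2, h3, h4⟩

@[simp] theorem chosen_mk {v : View} {M : ℕ → ℕ} {O : List ℕ} {k b m n t q μ : ℕ} :
    Chosen ⟨v.r, M, O⟩ k b m n t q μ ↔ Chosen v k b m n t q μ := by
  constructor <;> rintro ⟨h, h5, h6, h7⟩ <;> exact ⟨by simpa using h, h5, h6, h7⟩

@[simp] theorem chosen_set {v : View} {k b m n t q μ d x : ℕ} (hd : 8 ≤ d) :
    Chosen (v.set d x) k b m n t q μ ↔ Chosen v k b m n t q μ := by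
  have h1 : Holds (v.set d x) k b m n t ↔ Holds v k b m n t := holds_set (by omega)
  have e : ∀ i < 8, (v.set d x).r i = v.r i := fun i hi => by simp [show i ≠ d by omega]
  constructor <;> rintro ⟨h, h5, h6, h7⟩
  · rw [e _ (by norm_num)] at h5 h6 h7
    exact ⟨h1.1 h, h5, h6, h7⟩
  · rw [← e _ (by norm_num)] at h5 h6 h7
    exact ⟨h1.2 h, h5, h6, h7⟩

theorem Mode.q_pos {k b m n t q μ : ℕ} (h : Mode k b m n t q μ) : 1 ≤ q := by
  cases h <;> omega

theorem Mode.q_le {k b m n t q μ : ℕ} (h : Mode k b m n t q μ) (hk : 1 ≤ k) : q ≤ k := by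
  cases h <;> omega

/-! ### The prefix table of the pattern

The length of the longest common prefix of the pattern and its suffix at `d` is stored at address
`d`. Registers: `8` the current position, `9` and `10` the ends of the last partial match, `11` the
end up to which it may be extended, `12` whether the current position needs an extension. -/

def prefixInit : Cmd :=
  .seq (.store (.lit 0) (.reg 0)) <|
  .seq (.asg 9 (.lit 1)) <|
  .seq (.asg 10 (.lit 0)) <|
  .asg 8 (.lit 1)

def prefixBegin : Cmd :=
  .ifLt (.reg 8) (.reg 10)
    (.seq (.asg 13 (.load (.reg 8 - .reg 9))) <|
      .ifLt (.reg 13) (.reg 10 - .reg 8)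
        (.seq (.asg 12 (.lit 0)) (.asg 11 (.lit 0)))
        (.seq (.asg 9 (.reg 8)) (.seq (.asg 12 (.lit 1)) (.asg 11 (.reg 0)))))
    (.seq (.asg 9 (.reg 8)) (.seq (.asg 10 (.reg 8)) (.seq (.asg 12 (.lit 1)) (.asg 11 (.reg 0)))))

def prefixExtend : Cmd :=
  .ifEq (window .pat (.reg 10) (.lit 1)) (window .pat (.reg 10 - .reg 9) (.lit 1))
    (.asg 10 (.reg 10 + .lit 1)) (.asg 11 (.lit 0))

def prefixEnd : Cmd :=
  .seq (.ifEq (.reg 12) (.lit 1) (.asg 13 (.reg 10 - .reg 8)) (.asg 12 (.lit 0))) <|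
  .seq (.store (.reg 8) (.reg 13)) <|
  .asg 8 (.reg 8 + .lit 1)

def prefixPhase : Program :=
  .seq prefixInit.compile <| whileLt 8 0 <|
    .seq prefixBegin.compile <| .seq (whileLt 10 11 prefixExtend.compile) prefixEnd.compile

structure PrefixInv (v : View) (k b m n t q μ : ℕ) (g : ℕ → ℕ) (i : ℕ) : Prop where
  chosen : Chosen v k b m n t q μ
  out : v.out = []
  r8 : v.r 8 = i
  pos : 1 ≤ i
  l_pos : 1 ≤ v.r 9
  l_le : v.r 9 ≤ i
  r_le : v.r 10 ≤ m
  box : ∀ x, v.r 9 + x < v.r 10 → g (v.r 9 + x) = g x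
  table : ∀ d < m, d < i → IsPrefixLen g m d (v.mem d)

/-- Either the entry is copied from the table and waits in register `13`, or the box starts at `i`
and its right end is still being pushed. In the latter case `0` in register `11` stops the extension
and records a mismatch. -/
structure PrefixMid (v : View) (k b m n t q μ : ℕ) (g : ℕ → ℕ) (i : ℕ) : Prop
    extends PrefixInv v k b m n t q μ g i where
  lt : i < m
  status : (v.r 12 = 0 ∧ v.r 11 = 0 ∧ IsPrefixLen g m i (v.r 13)) ∨
    (v.r 12 = 1 ∧ v.r 9 = i ∧ i ≤ v.r 10 ∧
      (v.r 11 = m ∨ (v.r 11 = 0 ∧ v.r 10 < m ∧ g (v.r 10) ≠ g (v.r 10 - i))))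

section

variable {w : ℕ} {inp : Input w} {S k b m n t q μ : ℕ} {f g : ℕ → ℕ}

theorem isPrefixLen_zero (g : ℕ → ℕ) (m : ℕ) : IsPrefixLen g m 0 m :=
  ⟨by omega, by simp, by simp⟩

theorem vc_prefixInit (H : Setting inp S k b m n t f g) {v : View}
    (hv : Chosen v k b m n t q μ) (ho : v.out = []) :
    prefixInit.vc inp S (fun v => PrefixInv v k b m n t q μ g 1 ∧ v.r 10 = 0) v := by
  have hS : 0 < S := by have := H.space; have := H.t_ge; omega
  simp [prefixInit, hv.r0, H.w_ne, hS]
  constructor <;> simp [hv, ho]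
  rintro d - rfl
  simpa using isPrefixLen_zero g m

theorem vc_prefixBegin (H : Setting inp S k b m n t f g) {v : View} {i : ℕ}
    (hv : PrefixInv v k b m n t q μ g i) (hi : i < m) :
    prefixBegin.vc inp S (fun v' => PrefixMid v' k b m n t q μ g i ∧ v.r 10 ≤ v'.r 10) v := by
  have hS := H.space
  obtain ⟨hc, ho, h8, hpos, hl0, hl, hr, hbox, htab⟩ := hv
  simp [prefixBegin, hc.r0, h8, H.w_ne]
  refine ⟨fun hlt => ⟨⟨hl, by omega⟩, hlt.le, fun hz => ?_, fun hz => ?_⟩, fun hle => ⟨?_, hle⟩⟩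
  · have hp := htab (i - v.r 9) (by omega) (by omega)
    refine ⟨?_, hi, ?_⟩
    · constructor <;> (try simp) <;> assumption
    · left; simpa using IsPrefixLen.of_box hl hbox hr hp hz
  · have hp := htab (i - v.r 9) (by omega) (by omega)
    refine ⟨?_, hi, ?_⟩
    · constructor <;> (try simp) <;> try assumption
      exact box_shift hl hbox hp (by omega)
    · right; simp; exact hlt.le
  · refine ⟨?_, hi, ?_⟩
    · constructor <;> (try simp) <;> first | assumption | omega
    · right; simp

theorem vc_prefixExtend (H : Setting inp S k b m n t f g) {v : View} {i : ℕ}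
    (hv : PrefixMid v k b m n t q μ g i) (hlt : v.r 10 < v.r 11) :
    prefixExtend.vc inp S (fun v' => PrefixMid v' k b m n t q μ g i ∧
      (v'.r 10 = v.r 10 + 1 ∧ v'.r 11 = v.r 11 ∧ v.r 11 = m ∨
        v'.r 10 = v.r 10 ∧ v'.r 11 = 0)) v := by
  obtain ⟨⟨hc, ho, h8, hpos, hl0, hl, hr, hbox, htab⟩, hi, hs⟩ := hv
  have hn := H.n_lt
  have hmn := H.m_le
  obtain ⟨h12, h9, h10, h11⟩ : v.r 12 = 1 ∧ v.r 9 = i ∧ i ≤ v.r 10 ∧ v.r 11 = m := by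
    rcases hs with ⟨_, h, _⟩ | ⟨h12, h9, h10, h | ⟨h, _⟩⟩
    · omega
    · exact ⟨h12, h9, h10, h⟩
    · omega
  have d1 : v.r 10 / k ≤ v.r 10 := Nat.div_le_self _ _
  have d2 : (v.r 10 - i) / k ≤ v.r 10 - i := Nat.div_le_self _ _
  have v1 := val_window_pat H hc.r3 hc.r4 (p := .reg 10) (c := .lit 1) H.k_pos
  have v2 := val_window_pat H hc.r3 hc.r4 (p := .reg 10 - .reg 9) (c := .lit 1) H.k_pos
  have o1 := ok_window_pat H hc.r3 hc.r4 (p := .reg 10) (c := .lit 1) H.k_pos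
  have o2 := ok_window_pat H hc.r3 hc.r4 (p := .reg 10 - .reg 9) (c := .lit 1) H.k_pos
  simp [h9, blockCode_one, H.w_ne] at v1 v2 o1 o2
  simp [prefixExtend, v1, v2, o1, o2, H.w_ne]
  refine ⟨by omega, by omega, fun he => ⟨by omega, ⟨?_, hi, ?_⟩, h11⟩, fun he => ⟨?_, hi, ?_⟩⟩
  · constructor <;> (try simp) <;> try first | assumption | omega
    rw [h9] at hbox ⊢
    intro x hx
    by_cases h : i + x < v.r 10
    · exact hbox x h
    · have : x = v.r 10 - i := by omega
      rw [show i + x = v.r 10 by omega, this, he]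
  · right; simp; exact ⟨h12, h9, by omega, .inl h11⟩
  · constructor <;> (try simp) <;> assumption
  · right; simp; exact ⟨h12, h9, h10, .inr ⟨by omega, he⟩⟩

theorem vc_prefixEnd (H : Setting inp S k b m n t f g) {v : View} {i : ℕ}
    (hv : PrefixMid v k b m n t q μ g i) (hle : v.r 11 ≤ v.r 10) :
    prefixEnd.vc inp S (fun v' => PrefixInv v' k b m n t q μ g (i + 1) ∧ v'.r 10 = v.r 10) v := by
  obtain ⟨⟨hc, ho, h8, hpos, hl0, hl, hr, hbox, htab⟩, hi, hs⟩ := hv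
  have hn := H.n_lt
  have hmn := H.m_le
  have hS := H.space
  have htab' : ∀ z, IsPrefixLen g m i z → ∀ d < m, d ≤ i →
      IsPrefixLen g m d (Function.update v.mem i z d) := by
    intro z hz d hd hdi
    by_cases h : d = i
    · subst h; simpa using hz
    · rw [Function.update_of_ne h]; exact htab d hd (by omega)
  simp [prefixEnd, h8, H.w_ne]
  refine ⟨fun h1 => ?_, fun h1 => ?_⟩
  · obtain ⟨h9, h10, h11⟩ : v.r 9 = i ∧ i ≤ v.r 10 ∧
        (v.r 11 = m ∨ (v.r 11 = 0 ∧ v.r 10 < m ∧ g (v.r 10) ≠ g (v.r 10 - i))) := by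
      rcases hs with ⟨h, _⟩ | ⟨_, h⟩
      · omega
      · exact h
    refine ⟨h10, by omega, by omega, ?_⟩
    have hz : IsPrefixLen g m i (v.r 10 - i) := by
      refine ⟨by omega, fun j hj => ?_, fun hlt => ?_⟩
      · rw [h9] at hbox; exact hbox j (by omega)
      · rw [show i + (v.r 10 - i) = v.r 10 by omega] at hlt ⊢
        rcases h11 with h | ⟨_, _, h⟩
        · omega
        · exact h
    constructor <;> (try simp) <;> try first | assumption | omega
    exact htab' _ hz
  · have hz : IsPrefixLen g m i (v.r 13) := by
      rcases hs with ⟨_, _, h⟩ | ⟨h, _⟩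
      · exact h
      · omega
    refine ⟨by omega, by omega, ?_⟩
    constructor <;> (try simp) <;> try first | assumption | omega
    exact htab' _ hz

theorem wp_prefixBody (H : Setting inp S k b m n t f g) {v : View} {i N n' : ℕ}
    (hv : PrefixInv v k b m n t q μ g i) (hi : i < m)
    (hn' : N + 350 * (m - i) + 150 * (m - v.r 10) ≤ n') :
    WP inp S (.seq prefixBegin.compile <|
      .seq (whileLt 10 11 prefixExtend.compile) prefixEnd.compile)
      (fun v n' => ∃ i, PrefixInv v k b m n t q μ g i ∧
        N + 350 * (m - i) + 150 * (m - v.r 10) + 1 ≤ n') v n' := by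
  refine WP.seq (WP.cmd_of (n' - 50) 50 (by decide) (by omega) (vc_prefixBegin H hv hi) ?_)
  rintro v' ⟨hv', hle⟩
  refine WP.seq (WP.whileLt (by norm_num) (by norm_num)
      -- A successful comparison is paid by the advance of register `10`; the term with `min` pays
      -- for the one that fails and sets register `11` to `0`.
      (I := fun v n' => PrefixMid v k b m n t q μ g i ∧
        N + 350 * (m - (i + 1)) + 150 * (m - v.r 10) + 150 * min 1 (v.r 11 - v.r 10) + 52 ≤ n')
        ?_ ?_ _ _ ⟨hv', by omega⟩)
  · rintro v n' ⟨hv, hn'⟩ hlt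
    refine ⟨n' - 1, by omega, WP.cmd_of (n' - 150) 149
      (by simp [prefixExtend, window, Cmd.cost, Expr.cost]) (by omega)
      (vc_prefixExtend H hv hlt) ?_⟩
    exact fun v' ⟨hv', h⟩ => ⟨hv', by omega⟩
  · rintro v n' ⟨hv, hn'⟩ hle
    refine ⟨n' - 1, by omega, WP.cmd_of (n' - 51) 50 (by decide) (by omega)
      (vc_prefixEnd H hv hle) ?_⟩
    exact fun v' ⟨hv', h⟩ => ⟨_, hv', by omega⟩

theorem wp_prefix (H : Setting inp S k b m n t f g) {v : View}
    (hv : Chosen v k b m n t q μ) (ho : v.out = []) {N : ℕ} :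
    WP inp S prefixPhase (fun v n' => Chosen v k b m n t q μ ∧ v.out = [] ∧
      (∀ d < m, IsPrefixLen g m d (v.mem d)) ∧ n' = N) v (N + 500 * m + 21) := by
  refine WP.seq (WP.cmd_of (N + 500 * m + 1) 20 (by decide) (by omega) (vc_prefixInit H hv ho) ?_)
  rintro v ⟨hv, h10⟩
  refine WP.whileLt (by norm_num) (by norm_num)
    (I := fun v n' => ∃ i, PrefixInv v k b m n t q μ g i ∧
      N + 350 * (m - i) + 150 * (m - v.r 10) + 1 ≤ n') ?_ ?_ _ _ ⟨1, hv, by omega⟩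
  · rintro v n' ⟨i, hv, hn'⟩ hlt
    rw [hv.r8, hv.chosen.r0] at hlt
    exact ⟨n' - 1, by omega, wp_prefixBody H hv hlt (by omega)⟩
  · rintro v n' ⟨i, hv, hn'⟩ hle
    rw [hv.r8, hv.chosen.r0] at hle
    exact ⟨N, by omega, hv.chosen, hv.out, fun d hd => hv.table d hd (by omega), rfl⟩

end

/-! ### The anchor

Registers `15` and `16` receive the offset and the length of the anchor; register `14` runs through
the candidates for a short period of the pattern. -/

def anchorInit : Cmd :=
  .seq (.asg 15 (.lit 0)) <|
  .seq (.asg 16 (.lit 0)) <|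
  .seq (.asg 14 (.lit 1)) <|
  .seq (.asg 11 (.lit 0)) <|
  .ifEq (.reg 6) (.lit 1)
    (.ifLt (.reg 0) (.lit 2 * .reg 5) (.asg 16 (.reg 0))
      (.seq (.asg 16 (.lit 2 * .reg 5)) (.asg 11 (.reg 5))))
    (.asg 15 (.lit 0))

def anchorStep : Cmd :=
  .ifLt (.reg 14 + .load (.reg 14)) (.lit 2 * .reg 5)
    (.asg 14 (.reg 14 + .lit 1))
    (.seq (.asg 11 (.lit 0)) <|
      .ifLt (.reg 14 + .load (.reg 14)) (.reg 0)
        (.asg 15 (.reg 14 + .load (.reg 14) + .lit 1 - .lit 2 * .reg 5)) (.asg 15 (.lit 0)))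

def anchorPhase : Program := .seq anchorInit.compile (whileLt 14 11 anchorStep.compile)

structure Prepared (v : View) (k b m n t q μ : ℕ) (g : ℕ → ℕ) : Prop where
  chosen : Chosen v k b m n t q μ
  out : v.out = []
  table : ∀ d < m, IsPrefixLen g m d (v.mem d)

structure Anchored (v : View) (k b m n t q μ : ℕ) (g : ℕ → ℕ) (o l : ℕ) : Prop
    extends Prepared v k b m n t q μ g where
  r15 : v.r 15 = o
  r16 : v.r 16 = l
  anchor : IsAnchor g m q o l
  l_le : l ≤ 2 * q
  scan : μ = 0 → o = 0 ∧ l = 0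

@[simp] theorem prepared_set {v : View} {k b m n t q μ d x : ℕ} {g : ℕ → ℕ} (hd : 8 ≤ d) :
    Prepared (v.set d x) k b m n t q μ g ↔ Prepared v k b m n t q μ g := by
  constructor <;> rintro ⟨h1, h2, h3⟩
  · exact ⟨(chosen_set hd).1 h1, h2, h3⟩
  · exact ⟨(chosen_set hd).2 h1, h2, h3⟩

theorem Anchored.set {v : View} {k b m n t q μ d x o l : ℕ} {g : ℕ → ℕ}
    (h : Anchored v k b m n t q μ g o l) (hd : 8 ≤ d) (h15 : 15 ≠ d) (h16 : 16 ≠ d) :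
    Anchored (v.set d x) k b m n t q μ g o l :=
  ⟨(prepared_set hd).2 h.toPrepared, by simp [h15, h.r15], by simp [h16, h.r16], h.anchor, h.l_le,
    h.scan⟩

theorem Anchored.store {v : View} {k b m n t q μ a x o l : ℕ} {g : ℕ → ℕ}
    (h : Anchored v k b m n t q μ g o l) (ha : m ≤ a) :
    Anchored ⟨v.r, Function.update v.mem a x, v.out⟩ k b m n t q μ g o l := by
  obtain ⟨⟨h1, h2, h3⟩, h4, h5, h6, h7, h8⟩ := h
  refine ⟨⟨by simpa using h1, h2, fun d hd => ?_⟩, h4, h5, h6, h7, h8⟩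
  simpa [show d ≠ a by omega] using h3 d hd

/-- Register `11`, the bound of the loop, holds `q` during the search for a short period and `0` as
soon as one has been found or none is needed. -/
inductive AnchorInv (v : View) (k b m n t q μ : ℕ) (g : ℕ → ℕ) : Prop
  | done {o l : ℕ} (h : Anchored v k b m n t q μ g o l) (h11 : v.r 11 = 0)
  | search (h : Prepared v k b m n t q μ g) (hμ : μ = 1) (h11 : v.r 11 = q) (h15 : v.r 15 = 0)
      (h16 : v.r 16 = 2 * q) (hm : 2 * q ≤ m) (hpos : 1 ≤ v.r 14) (hle : v.r 14 ≤ q)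
      (hp : ∀ p, 0 < p → p < v.r 14 → p + v.mem p < 2 * q)

section

variable {w : ℕ} {inp : Input w} {S k b m n t q μ : ℕ} {f g : ℕ → ℕ}

theorem Mode.three_mul_lt (hM : Mode k b m n t q μ) (H : Setting inp S k b m n t f g) :
    3 * q < 2 ^ w := by
  have h2w := H.four_le
  have hw : w < 2 ^ w := Nat.lt_two_pow_self
  have h1 : k ≤ k * b := Nat.le_mul_of_pos_right _ H.b_pos
  have h2 := H.fits
  cases hM <;> omega

theorem Mode.q_le_t (hM : Mode k b m n t q μ) (H : Setting inp S k b m n t f g) : q ≤ t := by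
  cases hM with
  | table hq hk ht =>
    have : 3 * q ≤ 3 * q * b := Nat.le_mul_of_pos_right _ H.b_pos
    have := Nat.lt_two_pow_self (n := 3 * q * b)
    omega
  | scan => have := H.t_ge; omega

theorem Mode.flag_cases (hM : Mode k b m n t q μ) : μ = 0 ∨ μ = 1 := by
  cases hM <;> simp

theorem vc_anchorInit (H : Setting inp S k b m n t f g) (hM : Mode k b m n t q μ) {v : View}
    (hv : Prepared v k b m n t q μ g) :
    anchorInit.vc inp S (fun v => AnchorInv v k b m n t q μ g ∧ v.r 14 = 1 ∧ v.r 11 ≤ q) v := by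
  have h2w := H.four_le
  have h3q := hM.three_mul_lt H
  have hq := hM.q_pos
  simp [anchorInit, hv.chosen.r0, hv.chosen.r5, hv.chosen.r6, H.w_ne]
  refine ⟨fun hμ => ⟨by omega, fun h => ?_, fun h => ⟨by omega, ?_⟩⟩, fun hμ => ?_⟩
  · refine .done (o := 0) (l := m) ⟨by simpa using hv, ?_, ?_, isAnchor_self g m q, by omega,
      by omega⟩ ?_ <;> simp
  · refine .search (by simpa using hv) hμ ?_ ?_ ?_ h ?_ ?_ ?_ <;> simp
    · exact hq
    · intro p h1 h2; omega
  · have hμ0 : μ = 0 := by have := hM.flag_cases; omega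
    subst hμ0
    cases hM
    refine .done (o := 0) (l := 0) ⟨by simpa using hv, ?_, ?_, isAnchor_one g m, by omega,
      by omega⟩ ?_ <;> simp

theorem vc_anchorStep (H : Setting inp S k b m n t f g) (hM : Mode k b m n t q μ) {v : View}
    (hv : AnchorInv v k b m n t q μ g) (hlt : v.r 14 < v.r 11) :
    anchorStep.vc inp S (fun v' => AnchorInv v' k b m n t q μ g ∧
      v'.r 11 - v'.r 14 < v.r 11 - v.r 14) v := by
  have h2w := H.four_le
  have h3q := hM.three_mul_lt H
  have hS := H.space
  have hmn := H.m_le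
  have hn := H.n_lt
  cases hv with
  | done _ h11 => omega
  | search hv hμ h11 h15 h16 hm hpos hle hp =>
    have hz := hv.table (v.r 14) (by omega)
    have hzle := hz.le
    simp [anchorStep, hv.chosen.r0, hv.chosen.r5, H.w_ne]
    refine ⟨⟨by omega, by omega⟩, by omega, fun h => ⟨by omega, ?_, by omega⟩,
      fun h => ⟨by omega, fun hJ => ⟨⟨⟨by omega, by omega⟩, by omega, by omega⟩, ?_, by omega⟩,
        fun hJ => ⟨?_, by omega⟩⟩⟩
    · refine .search (by simpa using hv) hμ ?_ ?_ ?_ hm ?_ ?_ ?_ <;> simp <;> try omega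
      intro p h1 h2
      rcases Nat.lt_succ_iff_lt_or_eq.1 (Nat.lt_succ_of_le h2) with h3 | rfl
      · exact hp p h1 h3
      · exact h
    · refine .done ⟨by simpa using hv, by simp, by simp; exact h16,
        isAnchor_of_break (by omega) hz h hJ, le_rfl, by omega⟩ (by simp)
    · refine .done ⟨by simpa using hv, by simp, by simp; exact h16,
        isAnchor_of_periodic (by omega) (by omega) hz h (by omega), le_rfl, by omega⟩ (by simp)

theorem wp_anchor (H : Setting inp S k b m n t f g) (hM : Mode k b m n t q μ) {v : View}
    (hv : Prepared v k b m n t q μ g) {N : ℕ} :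
    WP inp S anchorPhase (fun v n' => (∃ o l, Anchored v k b m n t q μ g o l) ∧ n' = N) v
      (N + 100 * t + 41) := by
  have hqt := hM.q_le_t H
  refine WP.seq (WP.cmd_of (N + 100 * t + 1) 40 (by decide) (by omega) (vc_anchorInit H hM hv) ?_)
  rintro v ⟨hv, h14, h11⟩
  refine WP.whileLt (by norm_num) (by norm_num)
    (I := fun v n' => AnchorInv v k b m n t q μ g ∧ N + 100 * (v.r 11 - v.r 14) + 1 ≤ n')
    ?_ ?_ _ _ ⟨hv, by omega⟩
  · rintro v n' ⟨hv, hn'⟩ hlt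
    refine ⟨n' - 1, by omega, WP.cmd_of (n' - 100) 99 (by decide) (by omega)
      (vc_anchorStep H hM hv hlt) fun v' ⟨hv', h⟩ => ⟨hv', by omega⟩⟩
  · rintro v n' ⟨hv, hn'⟩ hle
    refine ⟨N, by omega, ?_, rfl⟩
    cases hv with
    | done h => exact ⟨_, _, h⟩
    -- The candidates below `q` are exhausted, so the prefix of length `2 * q` has no short period.
    | search h hμ h11 h15 h16 hm hpos hle' hp =>
      exact ⟨_, _, h, h15, h16, isAnchor_of_aperiodic hm h.table
        fun p h1 h2 => hp p h1 (by omega), le_rfl, by omega⟩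

end

/-! ### The table of shifts

The least shift at which the block with code `c` contains the anchor is stored at address `m + c`.
Register `17` receives the code of the anchor; register `18` runs through the codes. -/

def tableInit : Cmd :=
  .seq (.asg 17 (window .pat (.reg 15) (.reg 16))) <|
  .seq (.asg 18 (.lit 1)) <|
  .seq (.asg 11 (.lit 0)) <|
  .ifEq (.reg 6) (.lit 1)
    (.seq (.asg 11 (.reg 7)) <|
      .ifEq (.reg 17) (.lit 0) (.store (.reg 0) (.lit 0)) (.store (.reg 0) (.reg 5)))
    (.asg 18 (.lit 1))

def tableStep : Cmd :=
  .seq (.ifEq (.reg 18 % (Expr.lit 1).shl (.reg 16 * .reg 3)) (.reg 17)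
    (.store (.reg 0 + .reg 18) (.lit 0))
    (.seq (.asg 13 (.load (.reg 0 + (Expr.reg 18).shr (.reg 3)))) <|
      .ifLt (.reg 13) (.reg 5) (.store (.reg 0 + .reg 18) (.reg 13 + .lit 1))
        (.store (.reg 0 + .reg 18) (.reg 5)))) <|
  .asg 18 (.reg 18 + .lit 1)

def tablePhase : Program := .seq tableInit.compile (whileLt 18 11 tableStep.compile)

structure TableInv (v : View) (k b m n t q μ : ℕ) (g : ℕ → ℕ) (o l : ℕ) : Prop
    extends Anchored v k b m n t q μ g o l where
  r17 : v.r 17 = blockCode b g o l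
  pos : 1 ≤ v.r 18
  status : μ = 0 ∧ v.r 11 = 0 ∨ μ = 1 ∧ v.r 11 = 2 ^ (3 * q * b) ∧ v.r 18 ≤ v.r 11 ∧
    ∀ c < v.r 18, IsShift b q l (blockCode b g o l) c (v.mem (m + c))

section

variable {w : ℕ} {inp : Input w} {S k b m n t q μ o l : ℕ} {f g : ℕ → ℕ}

theorem Anchored.l_le_k {v : View} (hv : Anchored v k b m n t q μ g o l)
    (hM : Mode k b m n t q μ) : l ≤ k := by
  have h1 := hv.l_le
  have h2 := hv.scan
  cases hM <;> omega

/-- Reading a window fetches the following word as well, whose index must not overflow; only the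
last representable position with `k = 1` is critical. -/
theorem div_add_one_lt {p : ℕ} (H : Setting inp S k b m n t f g) (hp : p < 2 ^ w)
    (h : p + 1 < 2 ^ w ∨ 2 ≤ k) : p / k + 1 < 2 ^ w := by
  have h4 := H.four_le
  rcases h with h | h
  · have := Nat.div_le_self p k; omega
  · have : p / k ≤ p / 2 := Nat.div_le_div_left h (by norm_num)
    omega

theorem vc_tableInit (H : Setting inp S k b m n t f g) (hM : Mode k b m n t q μ) {v : View}
    (hv : Anchored v k b m n t q μ g o l) :
    tableInit.vc inp S (fun v => TableInv v k b m n t q μ g o l ∧ v.r 18 = 1 ∧ v.r 11 ≤ t) v := by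
  have h2w := H.four_le
  have hS := H.space
  have hmn := H.m_le
  have ht2 := H.t_ge
  have hn := H.n_lt
  have hlk := hv.l_le_k hM
  have hol := hv.anchor.le
  have hc := hv.chosen
  have hk : o / k + 1 < 2 ^ w := by
    refine div_add_one_lt H (by omega) ?_
    have := hv.scan
    cases hM <;> omega
  have v1 := val_window_pat H hc.r3 hc.r4 (p := .reg 15) (c := .reg 16) (by simpa [hv.r16])
  have o1 := ok_window_pat H hc.r3 hc.r4 (p := .reg 15) (c := .reg 16) (by simpa [hv.r16])
  simp [hv.r15, hv.r16, hk] at v1 o1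
  have hst : ∀ (u x : ℕ), Anchored ⟨((((v.set 17 u).set 18 1).set 11 0).set 11 (v.r 7)).r,
      Function.update v.mem m x, v.out⟩ k b m n t q μ g o l := by
    intro u x
    refine Anchored.store (Anchored.set (Anchored.set (Anchored.set (Anchored.set hv ?_ ?_ ?_)
      ?_ ?_ ?_) ?_ ?_ ?_) ?_ ?_ ?_) le_rfl <;> norm_num
  simp [tableInit, v1, o1, hc.r0, hc.r6, hc.r5, H.w_ne]
  refine ⟨fun hμ => ⟨fun hu => ⟨by omega, ?_, ?_⟩, fun hu => ⟨by omega, ?_, ?_⟩⟩, fun hμ => ?_⟩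
  · refine ⟨hst _ _, by simp, by simp, .inr ⟨hμ, ?_⟩⟩
    have h7 := hc.r7 hμ
    simp [h7, Nat.one_le_two_pow, hu]
    exact IsShift.of_eq (by simp)
  · rw [hc.r7 hμ]; cases hM <;> first | assumption | omega
  · refine ⟨hst _ _, by simp, by simp, .inr ⟨hμ, ?_⟩⟩
    have h7 := hc.r7 hμ
    simp [h7, Nat.one_le_two_pow]
    exact isShift_zero hu
  · rw [hc.r7 hμ]; cases hM <;> first | assumption | omega
  · have hμ0 : μ = 0 := by have := hM.flag_cases; omega
    refine ⟨?_, by simp, by simp, .inl ⟨hμ0, by simp⟩⟩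
    refine Anchored.set (Anchored.set (Anchored.set (Anchored.set hv ?_ ?_ ?_) ?_ ?_ ?_) ?_ ?_ ?_)
      ?_ ?_ ?_ <;> norm_num

theorem vc_tableStep (H : Setting inp S k b m n t f g) (hM : Mode k b m n t q μ) {v : View}
    (hv : TableInv v k b m n t q μ g o l) (hlt : v.r 18 < v.r 11) :
    tableStep.vc inp S (fun v' => TableInv v' k b m n t q μ g o l ∧
      v'.r 11 = v.r 11 ∧ v'.r 18 = v.r 18 + 1) v := by
  have h2w := H.four_le
  have hS := H.space
  have hmn := H.m_le
  have hn := H.n_lt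
  have ht := H.t_lt
  obtain ⟨hA, h17, hpos, hs⟩ := hv
  obtain ⟨hμ, h11, hle, htab⟩ : μ = 1 ∧ v.r 11 = 2 ^ (3 * q * b) ∧ v.r 18 ≤ v.r 11 ∧
      ∀ c < v.r 18, IsShift b q l (blockCode b g o l) c (v.mem (m + c)) := by
    rcases hs with ⟨_, _⟩ | h
    · omega
    · exact h
  have hc := hA.chosen
  -- The bounds `4 * m < n` and `4 * t < n` keep the table addresses `m + c` below `2 ^ w`.
  obtain ⟨hpt, hmn4, htn4, hk3⟩ : 2 ^ (3 * q * b) ≤ t ∧ 4 * m < n ∧ 4 * t < n ∧ 3 * q ≤ k := by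
    cases hM
    · exact ⟨by assumption, by assumption, by assumption, by assumption⟩
    · omega
  have hw : w < 2 ^ w := Nat.lt_two_pow_self
  have hlb : l * b ≤ 3 * q * b := Nat.mul_le_mul_right b (by have := hA.l_le; omega)
  have hqb : 3 * q * b ≤ w := (Nat.mul_le_mul_right b hk3).trans H.fits
  have hlp : 2 ^ (l * b) < 2 ^ w := lt_of_le_of_lt (Nat.pow_le_pow_right (by norm_num) hlb)
    (hpt.trans_lt ht)
  have h3q := hM.three_mul_lt H
  have hdiv : v.r 18 / 2 ^ b < v.r 18 :=
    Nat.div_lt_self (by omega) (Nat.one_lt_two_pow (by have := H.b_pos; omega))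
  have hfin : ∀ (v' : View), (∀ i, 8 ≤ i → i ≠ 13 → v'.r i = v.r i) → ∀ z,
      Anchored ⟨v'.r, Function.update v.mem (m + v.r 18) z, v.out⟩ k b m n t q μ g o l →
      IsShift b q l (blockCode b g o l) (v.r 18) z →
      TableInv (View.set ⟨v'.r, Function.update v.mem (m + v.r 18) z, v.out⟩ 18 (v.r 18 + 1))
        k b m n t q μ g o l := by
    intro v' hr z hA' hz
    refine ⟨hA'.set (by norm_num) (by norm_num) (by norm_num), ?_, by simp, .inr ⟨hμ, ?_, ?_, ?_⟩⟩
    · simp [hr, h17]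
    · simp [hr, h11]
    · simp [hr]; omega
    · intro c hc'
      simp at hc' ⊢
      by_cases h : c = v.r 18
      · subst h; simpa using hz
      · simpa [Function.update_apply, h] using htab c (by omega)
  -- Codes are treated in increasing order, so the entry of the block without its first character is
  -- already present.
  have hsh := htab _ hdiv
  simp [tableStep, hA.r16, hc.r0, hc.r3, hc.r5, H.w_ne, Nat.mod_eq_of_lt hlp, h17]
  refine ⟨by omega, fun he => ⟨by omega, by omega, by omega, ?_⟩,
    fun he => ⟨⟨by omega, by omega⟩, fun hd => ⟨by omega, by omega, by omega, by omega, ?_⟩,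
      fun hd => ⟨by omega, by omega, by omega, ?_⟩⟩⟩
  · exact hfin v (fun _ _ _ => rfl) _ (hA.store (by omega)) (IsShift.of_eq he)
  · refine hfin (v.set 13 _) ?_ _ (Anchored.store (hA.set ?_ ?_ ?_) (by omega)) ?_
    · intro i _ h; simp [h]
    any_goals norm_num
    simpa [hd] using hsh.step he
  · refine hfin (v.set 13 _) ?_ _ (Anchored.store (hA.set ?_ ?_ ?_) (by omega)) ?_
    · intro i _ h; simp [h]
    any_goals norm_num
    simpa [not_lt.2 hd] using hsh.step he

theorem wp_table (H : Setting inp S k b m n t f g) (hM : Mode k b m n t q μ) {v : View}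
    (hv : Anchored v k b m n t q μ g o l) {N : ℕ} :
    WP inp S tablePhase (fun v n' => Anchored v k b m n t q μ g o l ∧
      (μ = 1 → ∀ c < 2 ^ (3 * q * b), IsShift b q l (blockCode b g o l) c (v.mem (m + c))) ∧
      n' = N) v (N + 150 * t + 101) := by
  refine WP.seq (WP.cmd_of (N + 150 * t + 1) 100 (by simp [tableInit, window, Cmd.cost, Expr.cost])
    (by omega) (vc_tableInit H hM hv) ?_)
  rintro v ⟨hv, h18, h11⟩
  refine WP.whileLt (by norm_num) (by norm_num)
    (I := fun v n' => TableInv v k b m n t q μ g o l ∧ N + 150 * (v.r 11 - v.r 18) + 1 ≤ n')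
    ?_ ?_ _ _ ⟨hv, by omega⟩
  · rintro v n' ⟨hv, hn'⟩ hlt
    refine ⟨n' - 1, by omega, WP.cmd_of (n' - 150) 149 (by decide) (by omega)
      (vc_tableStep H hM hv hlt) fun v' ⟨hv', h⟩ => ⟨hv', by omega⟩⟩
  · rintro v n' ⟨hv, hn'⟩ hle
    refine ⟨N, by omega, hv.toAnchored, fun hμ c hc => ?_, rfl⟩
    rcases hv.status with h | ⟨_, h1, _, h3⟩
    · omega
    · exact h3 c (by omega)

end

/-! ### The search

Registers: `8` the first position that is still undecided, `9` and `10` the ends of the last partial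
match, `11` the end up to which it may be extended, `12` whether the candidate is alive, `19`
whether the search is over, `20` the last possible position, `21` the shift to the next candidate,
`22` the candidate, `23` the distance from the candidate to the next undecided position. -/

def searchInit : Cmd :=
  .seq (.asg 8 (.lit 0)) <|
  .seq (.asg 9 (.lit 0)) <|
  .seq (.asg 10 (.lit 0)) <|
  .seq (.asg 19 (.lit 0)) <|
  .seq (.asg 20 (.reg 1 - .reg 0)) <|
  .asg 25 (.lit 1)

def searchFind : Cmd :=
  .ifEq (.reg 6) (.lit 1)
    (.asg 21 (.load (.reg 0 + window .txt (.reg 8 + .reg 15) (.lit 3 * .reg 5))))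
    (.asg 21 (.lit 0))

/-- The end of the text is tested by subtraction, because `x + q` may overflow. A rejected candidate
leaves `0` in register `11`, so no comparison follows. -/
def searchBegin : Cmd :=
  .seq (.asg 22 (.reg 8)) <|
  .seq (.asg 23 (.reg 21)) <|
  .seq (.asg 11 (.lit 0)) <|
  .seq (.asg 12 (.lit 0)) <|
  .ifLt (.reg 21) (.reg 5)
    (.ifLt (.reg 20 - .reg 8) (.reg 21) (.asg 12 (.lit 0)) <|
      .seq (.asg 22 (.reg 8 + .reg 21)) <|
      .seq (.asg 23 (.reg 5)) <|
      .ifLt (.reg 22) (.reg 10)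
        (.seq (.asg 13 (.load (.reg 22 - .reg 9))) <|
          .ifLt (.reg 13) (.reg 10 - .reg 22) (.asg 12 (.lit 0)) <|
          .seq (.asg 9 (.reg 22)) <| .seq (.asg 11 (.reg 22 + .reg 0)) <| .asg 12 (.lit 1))
        (.seq (.asg 9 (.reg 22)) <| .seq (.asg 10 (.reg 22)) <|
          .seq (.asg 11 (.reg 22 + .reg 0)) <| .asg 12 (.lit 1)))
    (.asg 12 (.lit 0))

def searchBlock : Cmd :=
  .seq (.asg 18 (.reg 11 - .reg 10)) <|
  .ifLt (.reg 5) (.reg 18) (.asg 18 (.reg 5)) (.asg 18 (.reg 18))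

def searchCompare : Cmd :=
  .ifEq (window .txt (.reg 10) (.reg 18)) (window .pat (.reg 10 - .reg 9) (.reg 18))
    (.asg 10 (.reg 10 + .reg 18))
    (.seq (.asg 11 (.lit 0)) (.asg 12 (.lit 0)))

def searchEnd : Cmd :=
  .seq (.ifEq (.reg 12) (.lit 1) (.seq (.report (.reg 22)) (.asg 23 (.lit 1)))
    (.asg 12 (.lit 0))) <|
  .ifLt (.reg 20 - .reg 22) (.reg 23) (.asg 19 (.lit 1)) (.asg 8 (.reg 22 + .reg 23))

def searchBody : Program :=
  .seq searchFind.compile <| .seq searchBegin.compile <|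
    .seq (whileLt 10 11 (.seq searchBlock.compile searchCompare.compile)) searchEnd.compile

/-- Loop tests compare two registers, so register `25` keeps the constant `1` against which the flag
in register `19` is tested. -/
def searchPhase : Program := .seq searchInit.compile (whileLt 19 25 searchBody)

/-- The pattern `g` of length `m` occurs at position `s` of the text `f` of length `n`. -/
def Occurs (f g : ℕ → ℕ) (m n s : ℕ) : Prop := s + m ≤ n ∧ MatchAt f g m s

/-- The output consists of the occurrences before `x`. -/
def Reported (f g : ℕ → ℕ) (m n x : ℕ) (out : List ℕ) : Prop :=
  out.Nodup ∧ ∀ i, i ∈ out ↔ Occurs f g m n i ∧ i < x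

/-- What the search uses of the preprocessing. -/
structure Ready (v : View) (k b m n t q μ : ℕ) (g : ℕ → ℕ) (o l : ℕ) : Prop where
  chosen : Chosen v k b m n t q μ
  table : ∀ d < m, IsPrefixLen g m d (v.mem d)
  shifts : μ = 1 → ∀ c < 2 ^ (3 * q * b), IsShift b q l (blockCode b g o l) c (v.mem (m + c))
  r15 : v.r 15 = o
  r20 : v.r 20 = n - m
  r25 : v.r 25 = 1

@[simp] theorem ready_set {v : View} {k b m n t q μ d x o l : ℕ} {g : ℕ → ℕ} (hd : 8 ≤ d)
    (h15 : 15 ≠ d) (h20 : 20 ≠ d) (h25 : 25 ≠ d) :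
    Ready (v.set d x) k b m n t q μ g o l ↔ Ready v k b m n t q μ g o l := by
  constructor <;> rintro ⟨h1, h2, h3, h4, h5, h6⟩
  · exact ⟨(chosen_set hd).1 h1, h2, h3, by simpa [h15] using h4, by simpa [h20] using h5,
      by simpa [h25] using h6⟩
  · exact ⟨(chosen_set hd).2 h1, h2, h3, by simpa [h15] using h4, by simpa [h20] using h5,
      by simpa [h25] using h6⟩

@[simp] theorem ready_mk {v : View} {k b m n t q μ o l : ℕ} {g : ℕ → ℕ} {O : List ℕ} :
    Ready ⟨v.r, v.mem, O⟩ k b m n t q μ g o l ↔ Ready v k b m n t q μ g o l := by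
  constructor <;> rintro ⟨h1, h2, h3, h4, h5, h6⟩
  · exact ⟨chosen_mk.1 h1, h2, h3, h4, h5, h6⟩
  · exact ⟨chosen_mk.2 h1, h2, h3, h4, h5, h6⟩

/-- Registers `9` and `10` delimit a partial match. -/
structure Box (v : View) (f g : ℕ → ℕ) (m n : ℕ) : Prop where
  le : v.r 9 ≤ v.r 10
  le_m : v.r 10 ≤ v.r 9 + m
  le_n : v.r 10 ≤ n
  agree : ∀ x, v.r 9 + x < v.r 10 → f (v.r 9 + x) = g x

theorem Box.congr {v v' : View} {f g : ℕ → ℕ} {m n : ℕ} (h : Box v f g m n)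
    (h9 : v'.r 9 = v.r 9) (h10 : v'.r 10 = v.r 10) : Box v' f g m n := by
  obtain ⟨h1, h2, h3, h4⟩ := h
  constructor <;> simp only [h9, h10] <;> assumption

/-- The state at the beginning of a round whose first undecided position is `x`. -/
structure RoundInv (v : View) (k b m n t q μ : ℕ) (f g : ℕ → ℕ) (o l x : ℕ) : Prop where
  ready : Ready v k b m n t q μ g o l
  box : Box v f g m n
  r8 : v.r 8 = x
  r19 : v.r 19 = 0
  l_le : v.r 9 ≤ x
  x_le : x + m ≤ n
  reported : Reported f g m n x v.out

/-- The state after the shift to the next candidate has been found. -/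
structure Found (v : View) (k b m n t q μ : ℕ) (f g : ℕ → ℕ) (o l x : ℕ) : Prop
    extends RoundInv v k b m n t q μ f g o l x where
  le : v.r 21 ≤ q
  none : ∀ d < v.r 21, ¬ Occurs f g m n (x + d)
  anchor : v.r 21 < q → ∀ j < l, f (x + v.r 21 + o + j) = g (o + j)

/-- The state while the candidate in register `22` is examined. -/
structure Examine (v : View) (k b m n t q μ : ℕ) (f g : ℕ → ℕ) (o l x : ℕ) : Prop where
  ready : Ready v k b m n t q μ g o l
  box : Box v f g m n
  r19 : v.r 19 = 0
  l_le : v.r 9 ≤ v.r 22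
  x_le : x ≤ v.r 22
  s_le : v.r 22 + m ≤ n
  reported : Reported f g m n x v.out
  status : (v.r 12 = 0 ∧ v.r 11 = 0 ∧ (∀ y, x ≤ y → y < v.r 22 + v.r 23 → ¬ Occurs f g m n y) ∧
      (q ≤ v.r 23 ∨ n - m < v.r 22 + v.r 23)) ∨
    (v.r 12 = 1 ∧ v.r 11 = v.r 22 + m ∧ v.r 23 = q ∧ v.r 9 = v.r 22 ∧
      (∀ y, x ≤ y → y < v.r 22 → ¬ Occurs f g m n y) ∧
      ∀ j < l, f (v.r 22 + o + j) = g (o + j))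

section

variable {w : ℕ} {inp : Input w} {S k b m n t q μ o l x : ℕ} {f g : ℕ → ℕ}

/-! ### Correctness of the commands of the search -/

theorem vc_searchInit (H : Setting inp S k b m n t f g) {v : View}
    (hv : Anchored v k b m n t q μ g o l)
    (hs : μ = 1 → ∀ c < 2 ^ (3 * q * b), IsShift b q l (blockCode b g o l) c (v.mem (m + c))) :
    searchInit.vc inp S (fun v => RoundInv v k b m n t q μ f g o l 0) v := by
  simp [searchInit, H.w_ne, hv.chosen.r0, hv.chosen.r1, H.m_le]
  refine ⟨⟨by simpa using hv.chosen, hv.table, hs, ?_, ?_, ?_⟩, ⟨?_, ?_, ?_, ?_⟩, ?_, ?_, ?_, ?_, ?_⟩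
  all_goals simp [hv.r15, H.m_le, hv.out, Reported]

theorem vc_searchFind (H : Setting inp S k b m n t f g) (hM : Mode k b m n t q μ)
    (hA : IsAnchor g m q o l) (hl : l ≤ 2 * q) (hscan : μ = 0 → o = 0 ∧ l = 0) {v : View}
    (hv : RoundInv v k b m n t q μ f g o l x) :
    searchFind.vc inp S (fun v' => Found v' k b m n t q μ f g o l x ∧ v'.r 10 = v.r 10) v := by
  have h2w := H.four_le
  have hS := H.space
  have hn := H.n_lt
  have hmn := H.m_le
  have hc := hv.ready.chosen
  have hx := hv.x_le
  have hol := hA.le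
  have h3q := hM.three_mul_lt H
  have hround : ∀ y, RoundInv (v.set 21 y) k b m n t q μ f g o l x := by
    obtain ⟨h1, h2, h3, h4, h5, h6, h7⟩ := hv
    intro y
    exact ⟨by simpa using h1, h2.congr (by simp) (by simp), by simpa using h3, by simpa using h4,
      by simpa using h5, h6, h7⟩
  have hq := hM.q_pos
  by_cases hμ : μ = 1
  · subst hμ
    obtain ⟨hpt, hmn4, htn4, hk3⟩ : 2 ^ (3 * q * b) ≤ t ∧ 4 * m < n ∧ 4 * t < n ∧ 3 * q ≤ k := by
      cases hM
      exact ⟨by assumption, by assumption, by assumption, by assumption⟩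
    have hk : (x + o) / k + 1 < 2 ^ w := div_add_one_lt H (by omega) (by omega)
    have v1 := val_window_txt H hc.r3 hc.r4 (p := .reg 8 + .reg 15) (c := .lit 3 * .reg 5)
      (by simpa [hc.r5])
    have o1 := ok_window_txt H hc.r3 hc.r4 (p := .reg 8 + .reg 15) (c := .lit 3 * .reg 5)
      (by simpa [hc.r5])
    have hxo : x + o < 2 ^ w := by omega
    have h3w : 3 < 2 ^ w := by omega
    simp [hv.r8, hv.ready.r15, hc.r5, hk, h3q, hxo, h3w] at v1 o1
    have hlt := blockCode_lt H.f_lt (x + o) (3 * q)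
    have hsh := hv.ready.shifts rfl _ hlt
    -- A window of `3 * q` characters contains an anchor of length at most `2 * q` at every shift up
    -- to `q`.
    have key : ∀ d ≤ q, blockCode b f (x + o) (3 * q) / 2 ^ (d * b) % 2 ^ (l * b) =
        blockCode b g o l ↔ ∀ j < l, f (x + d + o + j) = g (o + j) := by
      intro d hd
      rw [blockCode_div H.f_lt _ (by omega), blockCode_mod H.f_lt _ (by omega),
        blockCode_inj H.f_lt H.g_lt, show x + o + d = x + d + o by omega]
    simp [searchFind, hc.r6, hc.r0, v1, o1, H.w_ne]
    refine ⟨⟨by omega, by omega⟩, hround _, ?_, ?_, ?_⟩ <;> simp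
    · exact hsh.le
    · intro d hd ⟨hd1, hd2⟩
      refine hsh.ne d hd ((key d (by have := hsh.le; omega)).2 fun j hj => ?_)
      rw [add_assoc]
      exact hd2 (o + j) (by omega)
    · intro hd
      exact (key _ hd.le).1 (hsh.eq hd)
  · have hμ0 : μ = 0 := by have := hM.flag_cases; omega
    simp [searchFind, hc.r6, hμ, H.w_ne]
    refine ⟨hround _, ?_, ?_, ?_⟩ <;> simp
    simp [(hscan hμ0).2]

theorem vc_searchBegin (H : Setting inp S k b m n t f g)
    (hA : IsAnchor g m q o l) {v : View}
    (hv : Found v k b m n t q μ f g o l x) :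
    searchBegin.vc inp S (fun v' => Examine v' k b m n t q μ f g o l x ∧ v.r 10 ≤ v'.r 10) v := by
  have hS := H.space
  have hn := H.n_lt
  have hmn := H.m_le
  have ht2 := H.t_ge
  obtain ⟨⟨hr, hbox, h8, h19, hlx, hxn, hrep⟩, hle, hnone, hanc⟩ := hv
  have hc := hr.chosen
  have hnone' : ∀ y, x ≤ y → y < x + v.r 21 → ¬ Occurs f g m n y := by
    intro y h1 h2 h3
    exact hnone (y - x) (by omega) (by rwa [show x + (y - x) = y by omega])
  obtain ⟨hb1, hb2, hb3, hb4⟩ := id hbox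
  simp [searchBegin, hc.r0, hc.r5, hr.r20, h8, H.w_ne]
  refine ⟨fun hd => ⟨by omega, fun hlim => ?_, fun hlim => ⟨by omega,
    fun hsR => ⟨⟨by omega, by omega⟩, by omega, fun hz => ?_, fun hz => ⟨by omega, ?_⟩⟩,
    fun hsR => ⟨by omega, ?_, by omega⟩⟩⟩, fun hd => ?_⟩
  · refine ⟨by simpa using hr, hbox.congr (by simp) (by simp), ?_, ?_, ?_, ?_, hrep, .inl ?_⟩ <;>
      simp <;> try assumption
    exact ⟨hnone', by omega⟩
  · have hz' := hr.table (x + v.r 21 - v.r 9) (by omega)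
    have hnm := not_matchAt_of_box (by omega) hb2 hb4 hz' hz
    refine ⟨by simpa using hr, hbox.congr (by simp) (by simp), ?_, ?_, ?_, ?_, hrep, .inl ?_⟩ <;>
      simp <;> try first | assumption | omega
    intro y h1 h2 h3
    rcases lt_trichotomy y (x + v.r 21) with h | h | h
    · exact hnone' y h1 h h3
    · exact hnm (h ▸ h3.2)
    -- The anchor was seen but the candidate fails, so the next `q - 1` positions are excluded too.
    · refine hA.skip f (x + v.r 21) (hanc hd) hnm (y - (x + v.r 21)) (by omega) (by omega) ?_
      rw [show x + v.r 21 + (y - (x + v.r 21)) = y by omega]; exact h3.2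
  · have hz' := hr.table (x + v.r 21 - v.r 9) (by omega)
    have hnm := box_shift (by omega) hb4 hz' (by omega)
    refine ⟨by simpa using hr, ⟨?_, ?_, ?_, ?_⟩, ?_, ?_, ?_, ?_, hrep, .inr ?_⟩ <;>
      simp <;> try first | assumption | omega
    exact ⟨hnone', hanc hd⟩
  · refine ⟨by simpa using hr, ⟨?_, ?_, ?_, ?_⟩, ?_, ?_, ?_, ?_, hrep, .inr ?_⟩ <;>
      simp <;> try first | assumption | omega
    exact ⟨hnone', hanc hd⟩
  · refine ⟨by simpa using hr, hbox.congr (by simp) (by simp), ?_, ?_, ?_, ?_, hrep, .inl ?_⟩ <;>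
      simp <;> try assumption
    exact ⟨hnone', .inl hd⟩

theorem vc_searchBlock {v : View} (hr : Ready v k b m n t q μ g o l) (hlt : v.r 10 < v.r 11) :
    searchBlock.vc inp S (fun v' => (∀ i, i ≠ 18 → v'.r i = v.r i) ∧ v'.mem = v.mem ∧
      v'.out = v.out ∧ v'.r 18 = min q (v.r 11 - v.r 10)) v := by
  simp [searchBlock, hr.chosen.r5, hlt.le]
  refine ⟨fun h => ⟨fun i hi => by simp [hi], by omega⟩,
    fun h => ⟨fun i hi => by simp [hi], by omega⟩⟩

theorem Examine.congr {v v' : View} (hv : Examine v k b m n t q μ f g o l x)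
    (hr : ∀ i, i ≠ 18 → v'.r i = v.r i) (hm : v'.mem = v.mem) (ho : v'.out = v.out) :
    Examine v' k b m n t q μ f g o l x := by
  obtain ⟨⟨⟨⟨a0, a1, a2, a3, a4⟩, a5, a6, a7⟩, b1, b2, b3, b4, b5⟩, c1, c2, c3, c4, c5, c6, c7⟩ := hv
  refine ⟨⟨⟨⟨?_, ?_, ?_, ?_, ?_⟩, ?_, ?_, ?_⟩, ?_, ?_, ?_, ?_, ?_⟩, c1.congr ?_ ?_, ?_, ?_, ?_, ?_, ?_,
    ?_⟩
  all_goals try simp only [hm, ho]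
  all_goals (repeat rw [hr _ (by norm_num)])
  all_goals assumption

theorem vc_searchCompare (H : Setting inp S k b m n t f g) (hM : Mode k b m n t q μ)
    (hA : IsAnchor g m q o l) {v : View} (hv : Examine v k b m n t q μ f g o l x)
    (hlt : v.r 10 < v.r 11) (h18 : v.r 18 = min q (v.r 11 - v.r 10)) :
    searchCompare.vc inp S (fun v' => Examine v' k b m n t q μ f g o l x ∧
      (v'.r 10 = v.r 10 + v.r 18 ∧ v'.r 11 = v.r 11 ∧ v.r 11 ≤ n ∨
        v'.r 10 = v.r 10 ∧ v'.r 11 = 0)) v := by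
  have hn := H.n_lt
  have hmn := H.m_le
  have hq := hM.q_pos
  have hqk := hM.q_le H.k_pos
  obtain ⟨hr, hbox, h19, hl, hxs, hsn, hrep, hst⟩ := hv
  obtain ⟨h12, h11, h23, h9, hnone, hanc⟩ := hst.resolve_left (by rintro ⟨_, h, _⟩; omega)
  obtain ⟨hb1, hb2, hb3, hb4⟩ := id hbox
  have hc := hr.chosen
  have hck : v.r 18 ≤ k := by omega
  have d1 : v.r 10 / k ≤ v.r 10 := Nat.div_le_self _ _
  have d2 : (v.r 10 - v.r 9) / k ≤ v.r 10 - v.r 9 := Nat.div_le_self _ _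
  have v1 := val_window_txt H hc.r3 hc.r4 (p := .reg 10) (c := .reg 18) hck
  have v2 := val_window_pat H hc.r3 hc.r4 (p := .reg 10 - .reg 9) (c := .reg 18) hck
  have o1 := ok_window_txt H hc.r3 hc.r4 (p := .reg 10) (c := .reg 18) hck
  have o2 := ok_window_pat H hc.r3 hc.r4 (p := .reg 10 - .reg 9) (c := .reg 18) hck
  simp at v1 v2 o1 o2
  simp [searchCompare, v1, v2, o1, o2, blockCode_inj H.f_lt H.g_lt]
  refine ⟨by omega, by omega, fun he => ⟨by omega, ?_, by omega⟩, fun j hj he => ?_⟩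
  · refine ⟨by simpa using hr, ⟨?_, ?_, ?_, ?_⟩, ?_, ?_, ?_, ?_, hrep, .inr ?_⟩ <;>
      simp <;> try first | assumption | omega
    · intro y hy
      by_cases h : v.r 9 + y < v.r 10
      · exact hb4 y h
      · have := he (v.r 9 + y - v.r 10) (by omega)
        rwa [show v.r 10 + (v.r 9 + y - v.r 10) = v.r 9 + y by omega,
          show v.r 10 - v.r 9 + (v.r 9 + y - v.r 10) = y by omega] at this
    · exact ⟨h12, h11, h23, h9, hnone, hanc⟩
  · have hnm : ¬ MatchAt f g m (v.r 22) := by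
      intro h
      have := h (v.r 10 - v.r 9 + j) (by omega)
      rw [show v.r 22 + (v.r 10 - v.r 9 + j) = v.r 10 + j by omega] at this
      exact he this
    refine ⟨by simpa using hr, hbox.congr (by simp) (by simp), ?_, ?_, ?_, ?_, hrep, .inl ?_⟩ <;>
      simp <;> try first | assumption | omega
    refine ⟨fun y h1 h2 h3 => ?_, by omega⟩
    rcases lt_trichotomy y (v.r 22) with h | h | h
    · exact hnone y h1 h h3
    · exact hnm (h ▸ h3.2)
    · refine hA.skip f (v.r 22) hanc hnm (y - v.r 22) (by omega) (by omega) ?_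
      rw [show v.r 22 + (y - v.r 22) = y by omega]; exact h3.2

theorem Reported.mono {y : ℕ} {out : List ℕ} (h : Reported f g m n x out) (hxy : x ≤ y)
    (hno : ∀ i, x ≤ i → i < y → ¬ Occurs f g m n i) : Reported f g m n y out := by
  refine ⟨h.1, fun i => (h.2 i).trans ⟨fun ⟨h1, h2⟩ => ⟨h1, by omega⟩, fun ⟨h1, h2⟩ => ⟨h1, ?_⟩⟩⟩
  by_contra h3
  exact hno i (by omega) h2 h1

theorem Reported.snoc {out : List ℕ} (h : Reported f g m n x out)
    (hx : Occurs f g m n x) : Reported f g m n (x + 1) (out ++ [x]) := by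
  refine ⟨?_, fun i => ?_⟩
  · rw [List.nodup_append]
    refine ⟨h.1, by simp, ?_⟩
    rintro a ha b hb rfl
    simp at hb
    have := ((h.2 a).1 ha).2
    omega
  · rw [List.mem_append, h.2, List.mem_singleton]
    constructor
    · rintro (⟨h1, h2⟩ | rfl)
      · exact ⟨h1, by omega⟩
      · exact ⟨hx, by omega⟩
    · rintro ⟨h1, h2⟩
      by_cases h3 : i = x
      · exact .inr h3
      · exact .inl ⟨h1, by omega⟩

theorem vc_searchEnd (H : Setting inp S k b m n t f g) (hM : Mode k b m n t q μ) {v : View}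
    (hv : Examine v k b m n t q μ f g o l x) (hle : v.r 11 ≤ v.r 10) :
    searchEnd.vc inp S (fun v' =>
      (v'.r 19 = 1 ∧ v'.r 25 = 1 ∧ Reported f g m n (n + 1) v'.out) ∨
      ∃ x', RoundInv v' k b m n t q μ f g o l x' ∧ v'.r 10 = v.r 10 ∧
        (x + q ≤ x' ∨ ∃ s, x ≤ s ∧ Occurs f g m n s ∧ x' = s + 1)) v := by
  have hn := H.n_lt
  have hmn := H.m_le
  have hq := hM.q_pos
  have h2w := H.four_le
  obtain ⟨hr, hbox, h19, hl, hxs, hsn, hrep, hst⟩ := hv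
  simp [searchEnd, hr.r20, H.w_ne]
  refine ⟨fun h12 => ⟨by omega, fun hlim => .inl ⟨hr.r25, ?_⟩, fun hlim => ⟨by omega, .inr ?_⟩⟩,
    fun h12 => ⟨by omega, fun hlim => .inl ⟨hr.r25, ?_⟩, fun hlim => ⟨by omega, .inr ?_⟩⟩⟩
  · obtain ⟨_, h11, h23, h9, hnone, hanc⟩ := hst.resolve_left (by rintro ⟨h, _⟩; omega)
    have hocc : Occurs f g m n (v.r 22) :=
      ⟨hsn, fun j hj => by have := hbox.agree j (by omega); rwa [h9] at this⟩
    refine ((hrep.mono hxs hnone).snoc hocc).mono (by omega) ?_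
    rintro i h1 h2 ⟨h3, _⟩
    omega
  · obtain ⟨_, h11, h23, h9, hnone, hanc⟩ := hst.resolve_left (by rintro ⟨h, _⟩; omega)
    have hocc : Occurs f g m n (v.r 22) :=
      ⟨hsn, fun j hj => by have := hbox.agree j (by omega); rwa [h9] at this⟩
    refine ⟨v.r 22 + 1, ⟨by simpa using hr, hbox.congr (by simp) (by simp), ?_, ?_, ?_, ?_, ?_⟩,
      .inr ⟨_, hxs, hocc, rfl⟩⟩ <;> (try simp) <;> try first | assumption | omega
    exact (hrep.mono hxs hnone).snoc hocc
  · obtain ⟨_, h11, hnone, hstep⟩ := hst.resolve_right (by rintro ⟨h, _⟩; omega)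
    refine hrep.mono (by omega) ?_
    rintro i h1 h2 h3
    exact hnone i h1 (by have := h3.1; omega) h3
  · obtain ⟨_, h11, hnone, hstep⟩ := hst.resolve_right (by rintro ⟨h, _⟩; omega)
    refine ⟨v.r 22 + v.r 23, ⟨by simpa using hr, hbox.congr (by simp) (by simp), ?_, ?_, ?_, ?_, ?_⟩,
      .inl (by omega)⟩ <;> (try simp) <;> try first | assumption | omega
    exact hrep.mono (by omega) hnone

/-! ### Amortised running time of the search -/

open Classical in
/-- The number of occurrences from position `x` on. -/
noncomputable def occCount (f g : ℕ → ℕ) (m n x : ℕ) : ℕ :=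
  ((Finset.range (n + 1)).filter fun i => x ≤ i ∧ Occurs f g m n i).card

theorem occCount_anti {y : ℕ} (h : x ≤ y) : occCount f g m n y ≤ occCount f g m n x := by
  classical
  refine Finset.card_le_card fun i => ?_
  simp only [Finset.mem_filter]
  exact fun ⟨h1, h2, h3⟩ => ⟨h1, h.trans h2, h3⟩

theorem occCount_succ {s : ℕ} (hs : Occurs f g m n s) :
    occCount f g m n (s + 1) + 1 ≤ occCount f g m n s := by
  classical
  refine Finset.card_lt_card (Finset.ssubset_iff_of_subset ?_ |>.2 ⟨s, ?_, ?_⟩)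
  · intro i
    simp only [Finset.mem_filter]
    exact fun ⟨h1, h2, h3⟩ => ⟨h1, by omega, h3⟩
  · simp only [Finset.mem_filter, Finset.mem_range]
    exact ⟨by have := hs.1; omega, le_rfl, hs⟩
  · simp

theorem sub_div_succ {N x q : ℕ} (hq : 1 ≤ q) (h : x + q ≤ N) :
    (N - (x + q)) / q + 1 = (N - x) / q := by
  rw [← Nat.add_div_right _ hq]; congr 1; omega

/-- The potential charges a round to `q` positions ruled out or to an occurrence reported, and a
full block comparison to the advance of register `10`, which never decreases. -/
theorem wp_searchBody (H : Setting inp S k b m n t f g) (hM : Mode k b m n t q μ)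
    (hA : IsAnchor g m q o l) (hl : l ≤ 2 * q) (hscan : μ = 0 → o = 0 ∧ l = 0) {v : View}
    (hv : RoundInv v k b m n t q μ f g o l x) {N n' : ℕ}
    (hn' : N + 1000 * ((n - m - x) / q + occCount f g m n x + 1) + 300 * ((n - v.r 10) / q) ≤ n') :
    WP inp S searchBody (fun v n' =>
      (v.r 19 = 1 ∧ v.r 25 = 1 ∧ Reported f g m n (n + 1) v.out ∧ N + 1 ≤ n') ∨
      ∃ x, RoundInv v k b m n t q μ f g o l x ∧
        N + 1000 * ((n - m - x) / q + occCount f g m n x + 1) + 300 * ((n - v.r 10) / q) + 1 ≤ n')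
      v n' := by
  have hq := hM.q_pos
  have hdx := Nat.zero_le ((n - m - x) / q)
  refine WP.seq (WP.cmd_of (n' - 100) 100 (by simp [searchFind, window, Cmd.cost, Expr.cost])
    (by omega) (vc_searchFind H hM hA hl hscan hv) ?_)
  rintro v₁ ⟨hv₁, h10⟩
  refine WP.seq (WP.cmd_of (n' - 200) 100 (by decide) (by omega) (vc_searchBegin H hA hv₁) ?_)
  rintro v₂ ⟨hv₂, h10'⟩
  have hdiv : (n - v₂.r 10) / q ≤ (n - v.r 10) / q := Nat.div_le_div_right (by omega)
  refine WP.seq (WP.whileLt (by norm_num) (by norm_num)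
    -- The term with `min` pays for a comparison that fails or is shorter than `q`; the loop stops
    -- after it.
    (I := fun v n' => Examine v k b m n t q μ f g o l x ∧
      N + 1000 * ((n - m - x) / q + occCount f g m n x) + 300 * ((n - v.r 10) / q) +
        300 * min 1 (v.r 11 - v.r 10) + 100 ≤ n') ?_ ?_ _ _ ⟨hv₂, by omega⟩)
  · rintro v n' ⟨hv, hn'⟩ hlt
    refine ⟨n' - 1, by omega, WP.seq (WP.cmd_of (n' - 51) 50 (by decide) (by omega)
      (vc_searchBlock hv.ready hlt) ?_)⟩
    rintro v₁ ⟨hr, hm, ho, h18⟩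
    have e10 := hr 10 (by norm_num)
    have e11 := hr 11 (by norm_num)
    refine WP.cmd_of (n' - 300) 249 (by simp [searchCompare, window, Cmd.cost, Expr.cost])
      (by omega) (vc_searchCompare H hM hA (hv.congr hr hm ho) (by omega) (by rw [h18, e10, e11]))
      ?_
    rintro v₂ ⟨hv₂, h | h⟩
    · refine ⟨hv₂, ?_⟩
      by_cases hfull : v.r 10 + q ≤ v.r 11
      · have : v₂.r 10 = v.r 10 + q := by omega
        have := sub_div_succ (N := n) (x := v.r 10) hq (by omega)
        rw [this.symm] at hn'
        rw [‹v₂.r 10 = v.r 10 + q›]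
        omega
      · have hdiv : (n - v₂.r 10) / q ≤ (n - v.r 10) / q := Nat.div_le_div_right (by omega)
        omega
    · refine ⟨hv₂, ?_⟩
      rw [h.1, e10]
      omega
  · rintro v n' ⟨hv, hn'⟩ hle
    refine ⟨n' - 1, by omega, WP.cmd_of (n' - 51) 50 (by decide) (by omega)
      (vc_searchEnd H hM hv hle) ?_⟩
    rintro v' (⟨h1, h2, h3⟩ | ⟨x', hx', h10, h⟩)
    · exact .inl ⟨h1, h2, h3, by omega⟩
    · refine .inr ⟨x', hx', ?_⟩
      rw [h10]
      have hx'n := hx'.x_le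
      rcases h with h | ⟨s, hs, hocc, rfl⟩
      · have e1 := sub_div_succ (N := n - m) (x := x) hq (by omega)
        have e2 : (n - m - x') / q ≤ (n - m - (x + q)) / q := Nat.div_le_div_right (by omega)
        have e3 : occCount f g m n x' ≤ occCount f g m n x := occCount_anti (by omega)
        omega
      · have e2 : (n - m - (s + 1)) / q ≤ (n - m - x) / q := Nat.div_le_div_right (by omega)
        have e3 := occCount_succ hocc
        have e4 : occCount f g m n s ≤ occCount f g m n x := occCount_anti hs
        omega

theorem wp_search (H : Setting inp S k b m n t f g) (hM : Mode k b m n t q μ) {v : View}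
    (hv : Anchored v k b m n t q μ g o l)
    (hs : μ = 1 → ∀ c < 2 ^ (3 * q * b), IsShift b q l (blockCode b g o l) c (v.mem (m + c)))
    {N : ℕ} :
    WP inp S searchPhase (fun v _ => Reported f g m n (n + 1) v.out) v
      (N + 1300 * (n / q) + 1000 * occCount f g m n 0 + 1051) := by
  have e : (n - m) / q ≤ n / q := Nat.div_le_div_right (by omega)
  refine WP.seq (WP.cmd_of (N + 1300 * (n / q) + 1000 * occCount f g m n 0 + 1001) 50 (by decide)
    (by omega) (vc_searchInit H hv hs) ?_)
  intro v₁ hv₁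
  have e2 : (n - v₁.r 10) / q ≤ n / q := Nat.div_le_div_right (by omega)
  refine WP.whileLt (by norm_num) (by norm_num)
    (I := fun v n' => (v.r 19 = 1 ∧ v.r 25 = 1 ∧ Reported f g m n (n + 1) v.out ∧ N + 1 ≤ n') ∨
      ∃ x, RoundInv v k b m n t q μ f g o l x ∧
        N + 1000 * ((n - m - x) / q + occCount f g m n x + 1) + 300 * ((n - v.r 10) / q) + 1 ≤ n')
    ?_ ?_ _ _ (.inr ⟨0, hv₁, by simp only [Nat.sub_zero]; omega⟩)
  · rintro v n' (⟨h1, h2, _⟩ | ⟨x, hx, hn'⟩) hlt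
    · omega
    · exact ⟨n' - 1, by omega, wp_searchBody H hM hv.anchor hv.l_le hv.scan hx (by omega)⟩
  · rintro v n' (⟨h1, h2, h3, h4⟩ | ⟨x, hx, hn'⟩) hlt
    · exact ⟨n' - 1, by omega, h3⟩
    · rw [hx.r19, hx.ready.r25] at hlt; omega

/-- The program of the main theorem. -/
def matchProgram : Program :=
  .seq choosePhase <| .seq prefixPhase <| .seq anchorPhase <| .seq tablePhase searchPhase

end

section

variable {w : ℕ} {inp : Input w} {S k b m n t : ℕ} {f g : ℕ → ℕ}

/-- The block length is only determined at run time, so the budget uses a bound `B` valid for all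
admissible modes. -/
theorem wp_matchProgram (H : Setting inp S k b m n t f g) {v : View} (hv : Holds v k b m n t)
    (ho : v.out = []) {B : ℕ} (hB : ∀ q μ, Mode k b m n t q μ → n / q ≤ B) :
    WP inp S matchProgram (fun v _ => Reported f g m n (n + 1) v.out) v
      (1300 * B + 1000 * occCount f g m n 0 + 500 * m + 280 * t + 1305) := by
  set X := 1300 * B + 1000 * occCount f g m n 0 + 1051 with hX
  rw [show 1300 * B + 1000 * occCount f g m n 0 + 500 * m + 280 * t + 1305 =
    (X + 150 * t + 101 + 100 * t + 41 + 500 * m + 21) + 30 * t + 91 by omega]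
  refine WP.seq ((wp_choose H hv ho).mono ?_)
  rintro v _ ⟨⟨q, μ, hM, hv⟩, ho, rfl⟩
  refine WP.seq ((wp_prefix H hv ho).mono ?_)
  rintro v _ ⟨hv, ho, ht, rfl⟩
  refine WP.seq ((wp_anchor H hM ⟨hv, ho, ht⟩).mono ?_)
  rintro v _ ⟨⟨o, l, hv⟩, rfl⟩
  refine WP.seq ((wp_table H hM hv).mono ?_)
  rintro v _ ⟨hv, hs, rfl⟩
  have := hB q μ hM
  rw [show X = (1300 * (B - n / q)) + 1300 * (n / q) + 1000 * occCount f g m n 0 + 1051 by omega]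
  exact wp_search H hM hv hs

end

/-! ### Packed strings -/

theorem charCode_lt {σ : ℕ} (hσ : 2 ≤ σ) (A : List (Fin σ)) (i : ℕ) :
    charCode A i < 2 ^ charBits σ := by
  refine lt_of_lt_of_le ?_ (Nat.le_pow_clog (by norm_num) σ)
  unfold charCode
  cases A[i]? with
  | none => simp; omega
  | some c => simp

theorem toNat_packedWord {w k σ : ℕ} (hσ : 2 ≤ σ) (hk : k * charBits σ ≤ w) (A : List (Fin σ))
    (x : ℕ) : (packedWord w k A x).toNat = blockCode (charBits σ) (charCode A) (x * k) k := by
  rw [packedWord, BitVec.toNat_ofNat]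
  exact Nat.mod_eq_of_lt ((blockCode_lt (charCode_lt hσ A) (x * k) k).trans_le
    (Nat.pow_le_pow_right (by norm_num) hk))

theorem charCode_of_lt {σ : ℕ} (A : List (Fin σ)) {i : ℕ} (h : i < A.length) :
    charCode A i = (A[i] : ℕ) := by
  simp [charCode, h]

theorem mem_occurrences {σ : ℕ} (P Q : List (Fin σ)) (i : ℕ) :
    i ∈ occurrences P Q ↔ Occurs (charCode Q) (charCode P) P.length Q.length i := by
  simp only [occurrences, Finset.mem_filter, Finset.mem_range, Occurs, MatchAt]
  rw [List.prefix_iff_getElem?]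
  constructor
  · rintro ⟨hi, h⟩
    have hlen : i + P.length ≤ Q.length := by
      by_contra hcon
      -- `P` is nonempty here because `i ≤ |Q|`, and its last character would lie past the end of
      -- `Q`.
      have := h (P.length - 1) (by omega)
      rw [List.getElem?_drop, List.getElem?_eq_none (by omega)] at this
      simp at this
    refine ⟨hlen, fun j hj => ?_⟩
    have := h j hj
    rw [List.getElem?_drop, List.getElem?_eq_getElem (by omega)] at this
    rw [charCode_of_lt Q (by omega), charCode_of_lt P hj, Option.some.inj this]
  · rintro ⟨hlen, h⟩
    refine ⟨by omega, fun j hj => ?_⟩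
    have := h j hj
    rw [charCode_of_lt Q (by omega), charCode_of_lt P hj] at this
    rw [List.getElem?_drop, List.getElem?_eq_getElem (by omega), Fin.ext this]

theorem occCount_zero {σ : ℕ} (P Q : List (Fin σ)) :
    occCount (charCode Q) (charCode P) P.length Q.length 0 = (occurrences P Q).card := by
  classical
  unfold occCount
  congr 1
  ext i
  rw [mem_occurrences, Finset.mem_filter, Finset.mem_range]
  exact ⟨fun h => h.2.2, fun h => ⟨by have := h.1; omega, by omega, h⟩⟩

theorem setting_packedInput {w σ k t S : ℕ} {P Q : List (Fin σ)} (hσ : 2 ≤ σ) (hk : 1 ≤ k)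
    (hkw : k * charBits σ ≤ w) (hPQ : P.length ≤ Q.length) (hQ : Q.length < 2 ^ w) (ht : 2 ≤ t)
    (htw : t < 2 ^ w) (hS : t + P.length ≤ S) :
    Setting (packedInput w k P Q) S k (charBits σ) P.length Q.length t (charCode Q)
      (charCode P) where
  b_pos := Nat.clog_pos (by norm_num) hσ
  k_pos := hk
  fits := hkw
  m_le := hPQ
  n_lt := hQ
  t_ge := ht
  t_lt := htw
  space := hS
  f_lt := charCode_lt hσ Q
  g_lt := charCode_lt hσ P
  txt := toNat_packedWord hσ hkw Q
  pat := toNat_packedWord hσ hkw P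

theorem holds_initState {w σ k t S : ℕ} {P Q : List (Fin σ)} {f g : ℕ → ℕ} {inp : Input w}
    (H : Setting inp S k (charBits σ) P.length Q.length t f g) (mem : BitVec w → BitVec w) :
    Holds (initState w k t P Q mem).view k (charBits σ) P.length Q.length t := by
  have hw : w < 2 ^ w := Nat.lt_two_pow_self
  have h1 : k ≤ k * charBits σ := Nat.le_mul_of_pos_right _ H.b_pos
  have h2 : charBits σ ≤ k * charBits σ := Nat.le_mul_of_pos_left _ H.k_pos
  have h3 := H.fits
  have h4 := H.n_lt
  have h5 := H.m_le
  have h6 := H.t_lt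
  constructor <;> simp only [State.view, initState, BitVec.toNat_ofNat] <;>
    exact Nat.mod_eq_of_lt (by omega)

/-! ### The running time -/

/-- Rounding up costs less than one bit, and `log₂ σ ≥ 1`. -/
theorem charBits_mul_log_le {σ : ℕ} (hσ : 2 ≤ σ) :
    (charBits σ : ℝ) * Real.log 2 ≤ 2 * Real.log σ := by
  have hb : 1 ≤ charBits σ := Nat.clog_pos (by norm_num) hσ
  have h1 : 2 ^ (charBits σ - 1) < σ := Nat.pow_pred_clog_lt_self (by norm_num) (by omega)
  have h2 : ((charBits σ - 1 : ℕ) : ℝ) * Real.log 2 ≤ Real.log σ := by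
    rw [← Real.log_pow]
    exact Real.log_le_log (by positivity) (by exact_mod_cast h1.le)
  have h3 : Real.log 2 ≤ Real.log σ := Real.log_le_log (by norm_num) (by exact_mod_cast hσ)
  rw [Nat.cast_sub hb] at h2
  push_cast at h2
  linarith

theorem logb_le_of_lt_two_pow {σ t c : ℕ} (hσ : 2 ≤ σ) (ht : 2 ≤ t)
    (h : t < 2 ^ (c * charBits σ)) : Real.logb σ t ≤ 2 * c := by
  have hlog : 0 < Real.log σ := Real.log_pos (by exact_mod_cast hσ)
  have h1 : Real.log t ≤ (c * charBits σ : ℕ) * Real.log 2 := by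
    rw [← Real.log_pow]
    exact Real.log_le_log (by positivity) (by exact_mod_cast h.le)
  rw [Real.logb, div_le_iff₀ hlog]
  push_cast at h1
  have := mul_le_mul_of_nonneg_left (charBits_mul_log_le hσ) (Nat.cast_nonneg (α := ℝ) c)
  linarith

/-- Either `k ≤ 6 * q`, where `log_σ t ≤ log_σ n ≤ a * k`, or `t < 2 ^ (c * charBits σ)` with `c ≤ 6
* q`, which gives `12 * q`. The factor `6` comes from `3 * (q + 1) ≤ 6 * q`. -/
theorem Mode.logb_le {σ k m n t q μ : ℕ} {a : ℝ} (h : Mode k (charBits σ) m n t q μ) (hσ : 2 ≤ σ)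
    (ht : 2 ≤ t) (ha : Real.logb σ n ≤ a * k) :
    Real.logb σ t ≤ (12 + 6 * |a|) * q ∨ n ≤ 4 * m + 4 * t + 3 := by
  by_cases hn : n ≤ 4 * m + 4 * t + 3
  · exact .inr hn
  left
  have hσ1 : (1 : ℝ) < σ := by exact_mod_cast hσ
  have hmono : Real.logb σ t ≤ |a| * k := by
    calc Real.logb σ t ≤ Real.logb σ n :=
          Real.logb_le_logb_of_le hσ1 (by positivity) (by exact_mod_cast (by omega : t ≤ n))
      _ ≤ a * k := ha
      _ ≤ |a| * k := by gcongr; exact le_abs_self a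
  have ha0 := abs_nonneg a
  have hsmall : ∀ c : ℕ, c ≤ 6 * q → t < 2 ^ (c * charBits σ) →
      Real.logb σ t ≤ (12 + 6 * |a|) * q := by
    intro c hc hlt
    have h1 := logb_le_of_lt_two_pow hσ ht hlt
    have h2 : (c : ℝ) ≤ 6 * q := by exact_mod_cast hc
    have : 0 ≤ 6 * |a| * q := by positivity
    linarith
  have hbig : k ≤ 6 * q → Real.logb σ t ≤ (12 + 6 * |a|) * q := by
    intro hk
    have h2 : (k : ℝ) ≤ 6 * q := by exact_mod_cast hk
    have := mul_le_mul_of_nonneg_left h2 ha0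
    have : (0 : ℝ) ≤ q := by positivity
    linarith
  cases h with
  | table hq hk ht' hmax hmn htn =>
    rcases hmax with h | h
    · exact hbig (by omega)
    · exact hsmall _ (by omega) h
  | scan h =>
    rcases h with h | h | h | h
    · omega
    · omega
    · exact hbig (by omega)
    · exact hsmall _ (by omega) h

theorem Mode.div_le {σ k m n t q μ : ℕ} {a : ℝ} (h : Mode k (charBits σ) m n t q μ) (hσ : 2 ≤ σ)
    (ht : 2 ≤ t) (ha : Real.logb σ n ≤ a * k) :
    ((n / q : ℕ) : ℝ) ≤ (12 + 6 * |a|) * (n / Real.logb σ t) + 4 * m + 4 * t + 3 := by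
  have hq : (0 : ℝ) < q := by exact_mod_cast h.q_pos
  have hlog : 0 < Real.logb σ t :=
    Real.logb_pos (by exact_mod_cast hσ) (by exact_mod_cast ht)
  have ha0 := abs_nonneg a
  rcases h.logb_le hσ ht ha with h1 | h1
  · have h2 : ((n / q : ℕ) : ℝ) ≤ n / q := Nat.cast_div_le
    have h3 : (n : ℝ) / q ≤ (12 + 6 * |a|) * (n / Real.logb σ t) := by
      rw [← mul_div_assoc, div_le_div_iff₀ hq hlog]
      calc (n : ℝ) * Real.logb σ t ≤ n * ((12 + 6 * |a|) * q) := by gcongr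
        _ = _ := by ring
    have : (0 : ℝ) ≤ 4 * m + 4 * t + 3 := by positivity
    linarith
  · have h2 : ((n / q : ℕ) : ℝ) ≤ 4 * m + 4 * t + 3 := by
      exact_mod_cast (Nat.div_le_self n q).trans h1
    have : 0 ≤ (12 + 6 * |a|) * (n / Real.logb σ t) := by positivity
    linarith

end PackedMatching

/-- The number `k` of characters per word is `Θ(log n / log σ)`: the lower bound is
`log_σ n ≤ a * k` for an arbitrary constant `a`, on which only the constant `C` may depend; the
upper bound is that `k` characters fit into a word. -/
theorem mainTheorem2 :
    ∃ prog : PackedMatching.Program, ∀ a : ℝ, ∃ C : ℕ,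
      ∀ (w σ k t : ℕ) (P Q : List (Fin σ)) (mem : BitVec w → BitVec w),
        2 ≤ σ → 1 ≤ k → k * PackedMatching.charBits σ ≤ w →
        Real.logb σ Q.length ≤ a * k →
        P.length ≤ Q.length → Q.length < 2 ^ w →
        2 ≤ t → t < 2 ^ w →
        ∃ (T : ℕ) (s : PackedMatching.State w),
          PackedMatching.Exec (PackedMatching.packedInput w k P Q) (C * (t + P.length)) prog
            (PackedMatching.initState w k t P Q mem) T s ∧
          PackedMatching.ReportsOccurrences P Q s.out ∧
          (T : ℝ) ≤ C * (Q.length / Real.logb σ t + t + P.length +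
            (PackedMatching.occurrences P Q).card) := by
  open PackedMatching in
  -- The ceiling covers the `1300 * (n / q)` steps of the search; `10000` covers the multiples of
  -- `t`, `m` and `occ`, and the additive constant through `t ≥ 2`.
  refine ⟨matchProgram, fun a => ⟨⌈1300 * (12 + 6 * |a|)⌉₊ + 10000, ?_⟩⟩
  intro w σ k t P Q mem hσ hk hkw ha hPQ hQ ht htw
  set C := ⌈1300 * (12 + 6 * |a|)⌉₊ + 10000 with hC
  have H := setting_packedInput (S := C * (t + P.length)) hσ hk hkw hPQ hQ ht htw
    (Nat.le_mul_of_pos_left _ (by omega))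
  set D : ℝ := Q.length / Real.logb σ t with hD
  have hD0 : 0 ≤ D :=
    div_nonneg (by positivity) (Real.logb_pos (by exact_mod_cast hσ) (by exact_mod_cast ht)).le
  have ha0 := abs_nonneg a
  have hB0 : 0 ≤ (12 + 6 * |a|) * D + 4 * P.length + 4 * t + 3 := by positivity
  obtain ⟨T, s, n', hexec, hT, hout⟩ := wp_matchProgram H (holds_initState H mem) rfl
    (B := ⌊(12 + 6 * |a|) * D + 4 * P.length + 4 * t + 3⌋₊)
    (fun q μ hM => Nat.le_floor (hM.div_le hσ ht ha)) _ rfl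
  refine ⟨T, s, hexec, ⟨hout.1.of_map _, fun i => ?_⟩, ?_⟩
  · rw [mem_occurrences]
    exact (hout.2 i).trans ⟨fun h => h.1, fun h => ⟨h, by have := h.1; omega⟩⟩
  · rw [occCount_zero] at hT
    have hT' : (T : ℝ) ≤ 1300 * (⌊(12 + 6 * |a|) * D + 4 * P.length + 4 * t + 3⌋₊ : ℕ) +
        1000 * (occurrences P Q).card + 500 * P.length + 280 * t + 1305 := by
      exact_mod_cast (Nat.le_add_right T n').trans hT
    have hfl := Nat.floor_le hB0
    have hCr : 1300 * (12 + 6 * |a|) + 10000 ≤ (C : ℝ) := by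
      rw [hC]; push_cast
      linarith [Nat.le_ceil (1300 * (12 + 6 * |a|))]
    have ht' : (2 : ℝ) ≤ t := by exact_mod_cast ht
    have hm0 : (0 : ℝ) ≤ P.length := by positivity
    have ho0 : (0 : ℝ) ≤ (occurrences P Q).card := by positivity
    have hY : 0 ≤ D + t + P.length + (occurrences P Q).card := by positivity
    refine le_trans ?_ (mul_le_mul_of_nonneg_right hCr hY)
    have : 0 ≤ |a| * (t + P.length + (occurrences P Q).card) := by positivity
    clear_value D
    linarith
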